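/- \textbf{Setting.} Let $\Sigma$ be a closed smooth surface and let $f_t:\Sigma\looparrowright\mathbb R^3$ $(t\in\mathbb R)$ be a smooth family of immersions, cooriented by a continuous family of unit normal fields $\nu_t$ along $f_t$ (equivalently, $\Sigma$ is oriented). Call a cooriented immersed surface in $\mathbb R^3$ (respectively curve in $\mathbb R^2$) \emph{generic} if at every point of the ambient space the normals of all sheets (branches) through that point are linearly independent. \textbf{Invariants.} The \emph{Alexander numbering} of a generic cooriented closed surface or plane curve is the function on the regions of its complement that increases by $1$ when a sheet is crossed along its coorientation and has a prescribed value on the region at infinity: $-\tfrac32$ for surfaces, and an arbitrary fixed real number $c$ for curves. The index $\operatorname{ind}$ of a triple point of a surface (of a double point of a curve) is the average of the numbering over the eight (four) locally adjacent regions. Put $$St_{(2)}(S)=\sum_{t\ \text{triple point of}\ S}\operatorname{ind}(t),\qquad St_{(1)}(C)=\sum_{d\ \text{double point of}\ C}\operatorname{ind}(d).$$ \textbf{Quadruple-point event.} Suppose that at time $t_0$ exactly four sheets of $f_{t_0}$, through distinct points $q_0,\dots,q_3\in\Sigma$, meet at a point $x_0$, any three of them transversely; that $f_{t_0}$ is generic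 away from $x_0$; and that $f_t$ is generic for $t\neq t_0$ close to $t_0$. \textbf{Slice plane.} Let $D\subset\Sigma$ be closed with $q_0$ in its interior (the moving sheet), and suppose that for $t$ near $t_0$ the sheet $f_t(D)$ lies in the slice plane $\underline{\mathbb R^2}_t=\{z=h(t)\}$ and is cooriented by the positive height direction, $\nu_t|_D=e_z$, and that some neighbourhood of $D$, not depending on $t$, meets $f_t^{-1}(\{z=h(t)\})$ only in $D$. Let $C_t\subset\underline{\mathbb R^2}_t\cong\mathbb R^2$ be the slice curve cut out by the other sheets, i.e. the image of $\{p\in\Sigma\setminus D: f_t(p)\in\underline{\mathbb R^2}_t\}$, cooriented by the horizontal part of $\nu_t$. Suppose that $C_t$ is generic for $t\ne t_0$ close to $t_0$ and that $C_{t_0}$ is generic away from the horizontal projection of $x_0$; thus the slice transition at $t_0$ is a Reidemeister move $\Omega_3$, whose vanishing triangle is bounded by the intersections of the moving sheet with the other three sheets. Let $T(t)$ be the triple point, close to $x_0$, of the sheets through $q_1,q_2,q_3$. The local transition is \emph{upward} if the slice plane lies below $T(t)$ for $t<t_0$ and above $T(t)$ for $t>t_0$ ($t$ near $t_0$), and \emph{downward}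 in the opposite case. Put $\operatorname{sgn}(\underline{\mathbb R^2})=-1$ if the transition is upward and $+1$ if it is downward. \textbf{Theorem.} If the local transition is upward or downward, there is $\varepsilon>0$ such that for all $t_1\in(t_0-\varepsilon,t_0)$, all $t_2\in(t_0,t_0+\varepsilon)$ and all $c\in\mathbb R$, with $dSt_{(2)}=St_{(2)}(f_{t_2})-St_{(2)}(f_{t_1})$ and $dSt_{(1)}=St_{(1)}(C_{t_2})-St_{(1)}(C_{t_1})$, $$dSt_{(2)}=dSt_{(1)}+\operatorname{sgn}(\underline{\mathbb R^2}).$$ -/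

import Mathlib

open Set Filter Topology
open scoped Manifold ContDiff

noncomputable section

/-- Euclidean 3-space; the height coordinate `z` is the coordinate with index `2`. -/
abbrev Space := EuclideanSpace ℝ (Fin 3)

/-- The Euclidean plane. -/
abbrev Plane := EuclideanSpace ℝ (Fin 2)

/-! ### Cooriented immersed hypersurfaces

A cooriented hypersurface of `E` is given by a map `f : X → E` and a normal field `ν : X → E` along
`f`. This covers surfaces in space as well as curves in the plane. -/

section Hypersurface

variable {X E : Type*} [NormedAddCommGroup E] [InnerProductSpace ℝ E]

/-- Only transverse multiple points: at every point of the ambient space the normals of all sheets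
through that point are linearly independent. In space this leaves transverse double and triple
points, in the plane transverse double points. -/
def IsGeneric (f ν : X → E) : Prop :=
  ∀ x : E, LinearIndependent ℝ (fun q : f ⁻¹' {x} => ν q)

/-- `a` is the Alexander numbering with value `c` on the region containing the point at infinity:
it is constant on the regions (the components of the complement of the image), equals `c` near
infinity, and increases by one whenever a sheet is crossed along its coorientation. The values of
`a` on the image itself are irrelevant. -/
structure IsAlexanderNumbering (c : ℝ) (f ν : X → E) (a : E → ℝ) : Prop where
  locally_constant : ∀ x, x ∉ range f → ∀ᶠ y in 𝓝 x, a y = a x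
  at_infinity : ∀ᶠ y in cocompact E, a y = c
  crossing : ∀ q : X, f ⁻¹' {f q} = {q} →
    ∀ᶠ s in 𝓝[>] (0 : ℝ), a (f q + s • ν q) = a (f q - s • ν q) + 1

/-- The Alexander numbering with value `c` at infinity. (For a generic immersed closed cooriented
hypersurface it exists and is unique off the image.) -/
def alexander (c : ℝ) (f ν : X → E) : E → ℝ :=
  Classical.epsilon (IsAlexanderNumbering c f ν)

/-- The regions locally adjacent to a transverse `k`-fold point `x` are the `2 ^ k` local sectors;
they correspond to the sets `T` of those sheets through `x` on whose positive side they lie.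
This is a vector at `x` pointing into the sector of `T`. -/
def sectorDirection (f ν : X → E) (x : E) (T : Set X) : E :=
  Classical.epsilon fun v : E => ∀ q ∈ f ⁻¹' {x},
    (q ∈ T → 0 < inner ℝ (ν q) v) ∧ (q ∉ T → inner ℝ (ν q) v < 0)

/-- The value of the numbering `a` on the sector of `T` at `x`. -/
def sectorValue (a : E → ℝ) (f ν : X → E) (x : E) (T : Set X) : ℝ :=
  limUnder (𝓝[>] (0 : ℝ)) fun s : ℝ => a (x + s • sectorDirection f ν x T)

/-- The index of a multiple point `x`: the average of the numbering `a` over the locally adjacent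
regions (eight of them at a triple point in space, four at a double point in the plane). -/
def pointIndex (a : E → ℝ) (f ν : X → E) (x : E) : ℝ :=
  (∑ᶠ (T : Set X) (_ : T ⊆ f ⁻¹' {x}), sectorValue a f ν x T) / 2 ^ (f ⁻¹' {x}).ncard

/-- The `k`-fold points. -/
def multiplePoints (k : ℕ) (f : X → E) : Set E :=
  {x | (f ⁻¹' {x}).ncard = k}

end Hypersurface

/-- `St_(2)`: the sum of the indices of the triple points, where the region at infinity has
number `-3/2`. -/
def StTwo {X : Type*} (f ν : X → Space) : ℝ :=
  ∑ᶠ x ∈ multiplePoints 3 f, pointIndex (alexander (-3 / 2) f ν) f ν x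

/-- `St_(1)`: the sum of the indices of the double points of a cooriented plane curve, where the
unbounded region has number `c`. -/
def StOne {X : Type*} (c : ℝ) (γ n : X → Plane) : ℝ :=
  ∑ᶠ x ∈ multiplePoints 2 γ, pointIndex (alexander c γ n) γ n x

/-! ### Regular homotopies and quadruple-point events -/

section Surface

variable {M : Type*} [TopologicalSpace M] [ChartedSpace (EuclideanSpace ℝ (Fin 2)) M]

/-- A smooth family `f t` of immersions of the surface `M` into space, together with its
coorientation, the continuous unit normal field `ν t` along `f t`. As space is oriented, an
orientation of `M` is the same thing as such a coorientation. -/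
structure IsRegularHomotopy (f ν : ℝ → M → Space) : Prop where
  smooth : ContMDiff (𝓘(ℝ, ℝ).prod (𝓡 2)) 𝓘(ℝ, Space) ∞ (fun p : ℝ × M => f p.1 p.2)
  immersion : ∀ t q, Function.Injective (mfderiv (𝓡 2) 𝓘(ℝ, Space) (f t) q)
  normal_continuous : Continuous (fun p : ℝ × M => ν p.1 p.2)
  normal_unit : ∀ t q, ‖ν t q‖ = 1
  normal_orthogonal : ∀ t q (v : TangentSpace (𝓡 2) q),
    inner ℝ (ν t q) (mfderiv (𝓡 2) 𝓘(ℝ, Space) (f t) q v : Space) = 0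

/-- At time `t₀` exactly four sheets, through the parameters `q 0, …, q 3`, meet at `x₀`, any three
of them transversely. There is no other degeneracy at time `t₀`, and none immediately before and
after. -/
structure IsQuadruplePointEvent (f ν : ℝ → M → Space) (t₀ : ℝ) (x₀ : Space) (q : Fin 4 → M) :
    Prop where
  injective : Function.Injective q
  fiber : f t₀ ⁻¹' {x₀} = range q
  general_position : ∀ i : Fin 4, LinearIndependent ℝ (fun j : {j : Fin 4 // j ≠ i} => ν t₀ (q j))
  generic_elsewhere : ∀ x, x ≠ x₀ → LinearIndependent ℝ (fun p : f t₀ ⁻¹' {x} => ν t₀ p)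
  generic_near : ∀ᶠ t in 𝓝[≠] t₀, IsGeneric (f t) (ν t)

/-! ### The slice plane -/

/-- The horizontal coordinates of a point (or vector) of space. -/
def horizontal (x : Space) : Plane := !₂[x 0, x 1]

/-- The parameters of the slice curve: the points outside the moving sheet `D` whose image lies on
the slice plane `z = h`. -/
def SliceDomain (f : M → Space) (D : Set M) (h : ℝ) : Type _ :=
  {p : M // p ∉ D ∧ f p 2 = h}

/-- The slice curve on the plane `z = h`, cut out by the sheets other than the sheet `D`. -/
def sliceCurve (f : M → Space) (D : Set M) (h : ℝ) (p : SliceDomain f D h) : Plane :=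
  horizontal (f p.1)

/-- The coorientation of the slice curve induced by the coorientation `ν` of the surface. -/
def sliceNormal (f ν : M → Space) (D : Set M) (h : ℝ) (p : SliceDomain f D h) : Plane :=
  horizontal (ν p.1)

/-- `St_(1)` of the slice curve. -/
def sliceStOne (c : ℝ) (f ν : M → Space) (D : Set M) (h : ℝ) : ℝ :=
  StOne c (sliceCurve f D h) (sliceNormal f ν D h)

/-- The plane `z = h t` is the slice plane of the event, with moving sheet `D` through `q 0`:
near time `t₀` the sheet `D` lies in the slice plane and is cooriented by the positive height
direction; near `D` the surface meets the slice plane in `D` only; and the slice curve (cut out by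
the other sheets) is generic immediately before and after the event, and at time `t₀` generic
except at the point of the event, so that the slice curve undergoes one `Ω3`-move there. -/
structure IsSlicePlane (f ν : ℝ → M → Space) (t₀ : ℝ) (x₀ : Space) (q : Fin 4 → M)
    (D : Set M) (h : ℝ → ℝ) : Prop where
  closed : IsClosed D
  mem_interior : q 0 ∈ interior D
  height : ∀ᶠ t in 𝓝 t₀, ∀ p ∈ D, f t p 2 = h t
  coorientation : ∀ᶠ t in 𝓝 t₀, ∀ p ∈ D, ν t p = EuclideanSpace.single 2 1
  isolated : ∃ U : Set M, IsOpen U ∧ D ⊆ U ∧ ∀ᶠ t in 𝓝 t₀, ∀ p ∈ U, f t p 2 = h t → p ∈ D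
  generic_near : ∀ᶠ t in 𝓝[≠] t₀,
    IsGeneric (sliceCurve (f t) D (h t)) (sliceNormal (f t) (ν t) D (h t))
  generic_elsewhere : ∀ y, y ≠ horizontal x₀ →
    LinearIndependent ℝ (fun p : sliceCurve (f t₀) D (h t₀) ⁻¹' {y} =>
      sliceNormal (f t₀) (ν t₀) D (h t₀) p)

/-- The direction in which the moving sheet passes the triple point of the other three sheets. -/
inductive Transition
  | upward
  | downward

/-- The sign of the slice plane. -/
def Transition.sgn : Transition → ℝ
  | .upward => -1
  | .downward => 1

/-- The triple point `T t` of the sheets through `q 1, q 2, q 3`, which is `x₀` at time `t₀`, is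
passed by the slice plane `z = h t` at time `t₀`. The local transition is upward if the plane is
below `T t` before the event and above it afterwards, and downward in the opposite case. -/
def IsLocalTransition (f : ℝ → M → Space) (t₀ : ℝ) (x₀ : Space) (q : Fin 4 → M) (h : ℝ → ℝ)
    (d : Transition) : Prop :=
  ∃ (T : ℝ → Space) (p : Fin 4 → ℝ → M),
    Tendsto T (𝓝 t₀) (𝓝 x₀) ∧
    (∀ i, i ≠ 0 → Tendsto (p i) (𝓝 t₀) (𝓝 (q i)) ∧ ∀ᶠ t in 𝓝 t₀, f t (p i t) = T t) ∧
    match d with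
    | .upward => (∀ᶠ t in 𝓝[<] t₀, h t < T t 2) ∧ ∀ᶠ t in 𝓝[>] t₀, T t 2 < h t
    | .downward => (∀ᶠ t in 𝓝[<] t₀, T t 2 < h t) ∧ ∀ᶠ t in 𝓝[>] t₀, h t < T t 2

end Surface

end

/-!
The proof never computes a change of an invariant region by region; it shows that both invariants
are, near the event, a constant plus a count of signs, and compares the counts.

Locally in space-time the moving surface is a union of sheets, each the zero set of a function that
is positive on the positive side (`IsRegularHomotopy.sheetFunction`). The number of sheets through
a point `z` on whose positive side `w` lies is, as a function of `w` near `z`, an Alexander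
numbering up to a constant. Since space is simply connected, these local numberings fit together to
one function `a` on space-time (`exists_primitive_of_germ_cocycle`,
`IsSheetFamily.exists_numbering`). An Alexander numbering is unique off the image
(`IsSheetSystem.eq_of_isAlexanderNumbering`), so `a` computes the indices: at a `k`-fold point `x`,
the index is `a (t, x) + k / 2` (`IsSheetSystem.pointIndex_alexander`), where `a (t, x)` is the
number of the region on the negative side of all sheets through `x`.

In dimension `n`, the `n`-fold points near a point `x` correspond to the `n`-element sets of sheets
through `x` (`IsSheetFamily.exists_branches`). Along such a branch, `a` equals its value at
`(t₀, x)` plus the number of the remaining sheets through `x` with the branch on their positive side.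
Hence away from an `(n + 1)`-fold point nothing changes, and at an `(n + 1)`-fold point the sum of
the indices is, up to a constant, the number of sheets on whose positive side the intersection of
the other `n` sheets lies (`IsSheetFamily.exists_sum_pointIndex_eq`). This applies to the surface
with `n = 3`, and to the slice curve with `n = 2`, whose defining functions are the restrictions of
those of the surface to the slice plane (`IsRegularHomotopy.isSheetFamily_slice`).

The intersection points of three sheets one of which is the slice plane are the double points of
the slice curve, so the two counts differ exactly by the term of the moving sheet: one if the
triple point of the other three sheets is above the slice plane, and zero if it is below
(`IsSlicePlane.eventually_StTwo_eq`). The sign of the slice plane is the change of this term.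
-/

noncomputable section

/-! ### Gluing local potentials -/

/-- Local potentials `N z`, any two of which differ locally by a constant, have a common primitive
`a` on a compact convex set. On balls whose intersections are connected the differences
`N z y - N z x` do not depend on `z`; the primitive sums them up along a subdivided segment from a base point,
and the sums for two nearby end points telescope. -/
theorem exists_primitive_of_germ_cocycle {V : Type*} [NormedAddCommGroup V] [NormedSpace ℝ V]
    {K : Set V} (hK : IsCompact K) (hconv : Convex ℝ K) (N : V → V → ℝ)
    (hN : ∀ z ∈ K, ∀ᶠ w in 𝓝 z, ∀ᶠ w' in 𝓝 w, N z w' = N z w + N w w') :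
    ∃ a : V → ℝ, ∀ z ∈ K, ∀ᶠ w in 𝓝 z, w ∈ K → a w = a z + N z w := by
  rcases K.eq_empty_or_nonempty with rfl | ⟨o, ho⟩
  · exact ⟨0, by simp⟩
  have h1 : ∀ z : K, ∃ r > 0, ∀ w ∈ Metric.ball (z : V) r, ∀ᶠ w' in 𝓝 w,
      N z w' = N z w + N w w' := fun z => by
    obtain ⟨r, hr, h⟩ := Metric.eventually_nhds_iff_ball.1 (hN z z.2)
    exact ⟨r, hr, h⟩
  choose r hr hNr using h1
  -- two of the local potentials differ by a constant on the intersection of their balls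
  have h2 : ∀ z z' : K, ∀ x ∈ Metric.ball (z : V) (r z) ∩ Metric.ball (z' : V) (r z'),
      ∀ y ∈ Metric.ball (z : V) (r z) ∩ Metric.ball (z' : V) (r z'),
      N z y - N z x = N z' y - N z' x := by
    intro z z' x hx y hy
    have hpre := ((convex_ball (z : V) (r z)).inter (convex_ball (z' : V) (r z'))).isPreconnected
    refine hpre.induction₂ (fun x y => N z y - N z x = N z' y - N z' x) ?_ ?_ ?_ hx hy
    · intro x hx
      refine Filter.Eventually.filter_mono nhdsWithin_le_nhds ?_
      filter_upwards [hNr z x hx.1, hNr z' x hx.2] with w h1 h2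
      rw [h1, h2]; ring
    · intro x y w _ _ _ h1 h2; linarith
    · intro x y _ _ h; linarith
  obtain ⟨ρ, hρ, hleb⟩ := lebesgue_number_lemma_of_metric
    (c := fun z : K => Metric.ball (z : V) (r z)) hK (fun _ => Metric.isOpen_ball)
    (fun x hx => mem_iUnion.2 ⟨⟨x, hx⟩, Metric.mem_ball_self (hr _)⟩)
  have : Nonempty K := ⟨⟨o, ho⟩⟩
  choose! ζ hζ using hleb
  have h3 : ∀ x ∈ K, ∀ z : K, ∀ y ∈ Metric.ball x ρ, x ∈ Metric.ball (z : V) (r z) →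
      y ∈ Metric.ball (z : V) (r z) → N (ζ x) y - N (ζ x) x = N z y - N z x :=
    fun x hx z y hy hxz hyz => h2 _ _ _ ⟨hζ x hx (Metric.mem_ball_self hρ), hxz⟩ _ ⟨hζ x hx hy, hyz⟩
  obtain ⟨R, hR⟩ := hK.isBounded.exists_norm_le
  obtain ⟨m, hm⟩ := exists_nat_gt (2 * R / (ρ / 2))
  have hR0 : 0 ≤ R := (norm_nonneg o).trans (hR o ho)
  have hm0 : (0 : ℝ) < m := lt_of_le_of_lt (by positivity) hm
  let pt : V → ℕ → V := fun x k => o + ((k : ℝ) / m) • (x - o)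
  have hpt0 : ∀ x, pt x 0 = o := fun x => by simp [pt]
  have hptm : ∀ x, pt x m = x := fun x => by simp [pt, hm0.ne']
  have hptK : ∀ x ∈ K, ∀ k ≤ m, pt x k ∈ K := fun x hx k hk =>
    hconv.add_smul_sub_mem ho hx ⟨by positivity, by
      rw [div_le_one hm0]; exact_mod_cast hk⟩
  have hstep : ∀ x ∈ K, ∀ k, dist (pt x (k + 1)) (pt x k) < ρ / 2 := by
    intro x hx k
    have : pt x (k + 1) - pt x k = (1 / (m : ℝ)) • (x - o) := by
      simp only [pt]; push_cast; rw [add_sub_add_left_eq_sub, ← sub_smul]; congr 1; ring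
    rw [dist_eq_norm, this, norm_smul, Real.norm_of_nonneg (by positivity)]
    have hxo : ‖x - o‖ ≤ 2 * R := (norm_sub_le _ _).trans (by linarith [hR x hx, hR o ho])
    rw [div_lt_iff₀ (by positivity)] at hm
    rw [one_div, inv_mul_lt_iff₀ hm0]
    linarith
  have hclose : ∀ x y k, k ≤ m → dist (pt y k) (pt x k) ≤ dist y x := by
    intro x y k hk
    have : pt y k - pt x k = ((k : ℝ) / m) • (y - x) := by
      simp only [pt]; rw [add_sub_add_left_eq_sub, ← smul_sub]; congr 1; abel
    rw [dist_eq_norm, this, norm_smul, Real.norm_of_nonneg (by positivity), dist_eq_norm]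
    refine mul_le_of_le_one_left (norm_nonneg _) ?_
    rw [div_le_one hm0]; exact_mod_cast hk
  let c : V → V → ℝ := fun x y => N (ζ x) y - N (ζ x) x
  refine ⟨fun x => ∑ k ∈ Finset.range m, c (pt x k) (pt x (k + 1)), fun z hz => ?_⟩
  have hζz := hNr (ζ z) z (hζ z hz (Metric.mem_ball_self hρ))
  filter_upwards [hζz, Metric.ball_mem_nhds z (half_pos hρ)] with w hw hwz hwK
  -- the sum telescopes over the squares between the two subdivided segments
  have hsq : ∀ k ∈ Finset.range m, c (pt w k) (pt w (k + 1)) - c (pt z k) (pt z (k + 1)) =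
      c (pt z (k + 1)) (pt w (k + 1)) - c (pt z k) (pt w k) := by
    intro k hk
    have hk : k < m := Finset.mem_range.1 hk
    have hwz : dist w z < ρ / 2 := hwz
    have hzk := hptK z hz k hk.le
    have hU := hζ _ hzk
    have d1 := hclose z w k hk.le
    have d2 := hclose z w (k + 1) hk
    have d3 := hstep z hz k
    have d4 := hstep w hwK k
    have e0 : pt z k ∈ Metric.ball (pt z k) ρ := Metric.mem_ball_self hρ
    have e1 : pt z (k + 1) ∈ Metric.ball (pt z k) ρ := by rw [Metric.mem_ball]; linarith
    have e2 : pt w k ∈ Metric.ball (pt z k) ρ := by rw [Metric.mem_ball]; linarith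
    have e3 : pt w (k + 1) ∈ Metric.ball (pt z k) ρ := by
      rw [Metric.mem_ball]; linarith [dist_triangle (pt w (k + 1)) (pt w k) (pt z k)]
    have f1 := h3 (pt w k) (hptK w hwK k hk.le) (ζ (pt z k)) (pt w (k + 1))
      (by rw [Metric.mem_ball]; linarith) (hU e2) (hU e3)
    have f2 := h3 (pt z (k + 1)) (hptK z hz (k + 1) hk) (ζ (pt z k)) (pt w (k + 1))
      (by rw [Metric.mem_ball]; linarith) (hU e1) (hU e3)
    simp only [c]
    rw [f1, f2]; ring
  have hsum := Finset.sum_congr rfl hsq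
  rw [Finset.sum_sub_distrib, Finset.sum_range_sub (fun k => c (pt z k) (pt w k)), hptm, hptm, hpt0,
    hpt0] at hsum
  simp only [c, sub_self, sub_zero] at hsum ⊢
  linarith

/-! ### Hypersurfaces as systems of sheets -/

theorem LinearIndependent.exists_inner_eq {E : Type*} [NormedAddCommGroup E] [InnerProductSpace ℝ E]
    [FiniteDimensional ℝ E] {ι : Type*} {ν : ι → E} (hν : LinearIndependent ℝ ν)
    (c : ι → ℝ) :
    ∃ v : E, ∀ i, inner ℝ (ν i) v = c i := by
  let φ₀ : Submodule.span ℝ (range ν) →ₗ[ℝ] ℝ := (Module.Basis.span hν).constr ℝ c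
  obtain ⟨φ, hφ⟩ := φ₀.exists_extend
  refine ⟨(InnerProductSpace.toDual ℝ E).symm (LinearMap.toContinuousLinearMap φ), fun i => ?_⟩
  rw [real_inner_comm, InnerProductSpace.toDual_symm_apply]
  have h1 := LinearMap.congr_fun hφ (Module.Basis.span hν i)
  rw [LinearMap.comp_apply, (Module.Basis.span hν).constr_basis] at h1
  rw [← h1]
  simp [Module.Basis.span_apply]

theorem tendsto_ray {E : Type*} [NormedAddCommGroup E] [NormedSpace ℝ E] (x v : E) :
    Tendsto (fun s : ℝ => x + s • v) (𝓝[>] 0) (𝓝 x) := by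
  have : Tendsto (fun s : ℝ => x + s • v) (𝓝 0) (𝓝 (x + (0 : ℝ) • v)) :=
    Continuous.tendsto (by fun_prop) 0
  simpa using this.mono_left nhdsWithin_le_nhds

section Static

variable {E : Type*} [NormedAddCommGroup E] [InnerProductSpace ℝ E] {X : Type*}

/-- A cooriented hypersurface `f` with normals `ν`, given together with a defining function `g p` of
the sheet through each `p`, and a function `a` which rises by one across every sheet.

Near `x` the sheets are the zero sets of the functions `g p` with `f p = x`: the points of the
hypersurface at `y` correspond, under `β`, to those `p` for which `g p y = 0`. The convention
`0 < g p y` in `count` makes `a x`, at a point `x` of the image, the value of `a` on the adjacent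
region which lies on the negative side of all sheets. -/
structure IsSheetSystem (f ν : X → E) (g : X → E → ℝ) (a : E → ℝ) : Prop where
  finite : ∀ x, (f ⁻¹' {x}).Finite
  deriv : ∀ p, HasStrictFDerivAt (g p) (innerSL ℝ (ν p)) (f p)
  zero : ∀ p, g p (f p) = 0
  near : ∀ x, ∀ᶠ y in 𝓝 x, ∃ β : f ⁻¹' {y} → f ⁻¹' {x},
    Function.Injective β ∧ ∀ p, p ∈ range β ↔ g p y = 0
  count : ∀ x, ∀ᶠ y in 𝓝 x, a y = a x + ({p | f p = x ∧ 0 < g p y}.ncard : ℝ)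

namespace IsSheetSystem

variable {f ν : X → E} {g : X → E → ℝ} {a : E → ℝ}

theorem add_const (H : IsSheetSystem f ν g a) (c : ℝ) :
    IsSheetSystem f ν g (fun x => a x + c) where
  finite := H.finite
  deriv := H.deriv
  zero := H.zero
  near := H.near
  count x := by filter_upwards [H.count x] with y hy; rw [hy]; ring

theorem eventually_mem_range (H : IsSheetSystem f ν g a) (x : E) :
    ∀ᶠ y in 𝓝 x, y ∈ range f ↔ ∃ p, f p = x ∧ g p y = 0 := by
  filter_upwards [H.near x] with y ⟨β, _, hr⟩
  constructor
  · rintro ⟨p, hp⟩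
    exact ⟨β ⟨p, hp⟩, (β ⟨p, hp⟩).2, (hr _).1 (mem_range_self _)⟩
  · rintro ⟨p, hp, h0⟩
    obtain ⟨p', _⟩ := (hr ⟨p, hp⟩).2 h0
    exact ⟨p', p'.2⟩

theorem eventually_subsingleton (H : IsSheetSystem f ν g a) (x : E) :
    ∀ᶠ y in 𝓝 x, (∀ p q, f p = x → f q = x → g p y = 0 → g q y = 0 → p = q) →
      (f ⁻¹' {y}).Subsingleton := by
  filter_upwards [H.near x] with y ⟨β, hi, hr⟩ h p hp q hq
  have := hi (Subtype.ext (h _ _ (β ⟨p, hp⟩).2 (β ⟨q, hq⟩).2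
    ((hr _).1 (mem_range_self _)) ((hr _).1 (mem_range_self _))))
  exact congrArg Subtype.val this

/-- Along a ray from the sheet, `g p` grows at the rate prescribed by the normal. -/
theorem tendsto_slope (H : IsSheetSystem f ν g a) (p : X) (v : E) :
    Tendsto (fun s : ℝ => g p (f p + s • v) / s) (𝓝[>] 0) (𝓝 (inner ℝ (ν p) v)) := by
  have h2 : HasDerivAt (fun s : ℝ => f p + s • v) v 0 := by
    simpa using ((hasDerivAt_id (0 : ℝ)).smul_const v).const_add (f p)
  have h3 : HasFDerivAt (g p) (innerSL ℝ (ν p)) (f p + (0 : ℝ) • v) := by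
    simpa using (H.deriv p).hasFDerivAt
  have h1 := h3.comp_hasDerivAt (0 : ℝ) h2
  rw [innerSL_apply_apply, Function.comp_def] at h1
  have h4 := h1.hasDerivWithinAt (s := Ioi 0)
  rw [hasDerivWithinAt_iff_tendsto_slope' (by simp)] at h4
  simpa [slope_fun_def_field, H.zero p] using h4

theorem eventually_pos (H : IsSheetSystem f ν g a) (p : X) {v : E} (hv : 0 < inner ℝ (ν p) v) :
    ∀ᶠ s in 𝓝[>] (0 : ℝ), 0 < g p (f p + s • v) := by
  filter_upwards [(H.tendsto_slope p v).eventually (lt_mem_nhds hv), self_mem_nhdsWithin]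
    with s hs hs0
  exact (div_pos_iff_of_pos_right hs0).1 hs

theorem eventually_neg (H : IsSheetSystem f ν g a) (p : X) {v : E} (hv : inner ℝ (ν p) v < 0) :
    ∀ᶠ s in 𝓝[>] (0 : ℝ), g p (f p + s • v) < 0 := by
  filter_upwards [(H.tendsto_slope p v).eventually (gt_mem_nhds hv), self_mem_nhdsWithin]
    with s hs hs0
  have hs0 : 0 < s := hs0
  by_contra h
  exact hs.not_ge (div_nonneg (not_lt.1 h) hs0.le)

/-- A ray from `x` into the sector of `T`, together with the value of `a` there. -/
theorem eventually_sector (H : IsSheetSystem f ν g a) {x : E} {T : Set X} (hT : T ⊆ f ⁻¹' {x})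
    {v : E} (hv : ∀ q ∈ f ⁻¹' {x}, (q ∈ T → 0 < inner ℝ (ν q) v) ∧ (q ∉ T → inner ℝ (ν q) v < 0)) :
    ∀ᶠ s in 𝓝[>] (0 : ℝ), x + s • v ∉ range f ∧ a (x + s • v) = a x + T.ncard := by
  have h1 : ∀ᶠ s in 𝓝[>] (0 : ℝ), ∀ q ∈ f ⁻¹' {x},
      (q ∈ T → 0 < g q (x + s • v)) ∧ (q ∉ T → g q (x + s • v) < 0) := by
    rw [(H.finite x).eventually_all]
    intro q hq
    have hq' : f q = x := hq
    by_cases hqT : q ∈ T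
    · filter_upwards [H.eventually_pos q ((hv q hq).1 hqT)] with s hs
      exact ⟨fun _ => hq' ▸ hs, fun h => absurd hqT h⟩
    · filter_upwards [H.eventually_neg q ((hv q hq).2 hqT)] with s hs
      exact ⟨fun h => absurd h hqT, fun _ => hq' ▸ hs⟩
  filter_upwards [h1, (tendsto_ray x v).eventually (H.eventually_mem_range x),
    (tendsto_ray x v).eventually (H.count x)] with s hs hr hc
  constructor
  · rw [hr]
    rintro ⟨p, hp, h0⟩
    by_cases hpT : p ∈ T
    · exact ((hs p hp).1 hpT).ne' h0
    · exact ((hs p hp).2 hpT).ne h0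
  · rw [hc]
    congr 3
    ext p
    constructor
    · rintro ⟨hp, h0⟩
      by_contra hpT
      exact h0.not_gt ((hs p hp).2 hpT)
    · exact fun hpT => ⟨hT hpT, (hs p (hT hpT)).1 hpT⟩

theorem isAlexanderNumbering (H : IsSheetSystem f ν g a) (hgen : IsGeneric f ν) {c : ℝ}
    (hc : ∀ᶠ y in cocompact E, a y = c) : IsAlexanderNumbering c f ν a where
  locally_constant x hx := by
    filter_upwards [H.count x] with y hy
    have : {p | f p = x ∧ 0 < g p y} = ∅ := by
      ext p
      simp only [mem_ofPred_eq, mem_empty_iff_false, iff_false]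
      exact fun h => hx ⟨p, h.1⟩
    simpa [this] using hy
  at_infinity := hc
  crossing q hq := by
    have hν : ν q ≠ 0 := (hgen (f q)).ne_zero (⟨q, rfl⟩ : f ⁻¹' {f q})
    have h0 : 0 < inner ℝ (ν q) (ν q) := real_inner_self_pos.2 hν
    have h1 := H.eventually_sector (x := f q) (T := {q}) (v := ν q) (by simp) (by
      rw [hq]; simp only [mem_singleton_iff, forall_eq, true_imp_iff, not_true_eq_false,
        false_imp_iff, and_true]
      exact h0)
    have h2 := H.eventually_sector (x := f q) (T := ∅) (v := -ν q) (by simp) (by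
      rw [hq]; simp only [mem_singleton_iff, forall_eq]
      refine ⟨fun h => absurd h (notMem_empty _), fun _ => ?_⟩
      rw [inner_neg_right]; linarith)
    filter_upwards [h1, h2] with s h1 h2
    have h2' := h2.2
    rw [smul_neg, ← sub_eq_add_neg] at h2'
    rw [h1.2, h2']; simp

variable [FiniteDimensional ℝ E]

/-- At a transverse multiple point every sign pattern is realized by a direction. -/
theorem exists_sectorDirection {x : E}
    (hli : LinearIndependent ℝ (fun q : f ⁻¹' {x} => ν q)) (T : Set X) :
    ∃ v : E, ∀ q ∈ f ⁻¹' {x}, (q ∈ T → 0 < inner ℝ (ν q) v) ∧ (q ∉ T → inner ℝ (ν q) v < 0) := by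
  classical
  obtain ⟨v, hv⟩ := hli.exists_inner_eq (fun q => if (q : X) ∈ T then 1 else -1)
  refine ⟨v, fun q hq => ?_⟩
  have := hv ⟨q, hq⟩
  simp only at this
  rw [this]
  constructor <;> intro h <;> simp [h]

theorem frequently_notMem_range (H : IsSheetSystem f ν g a) (hgen : IsGeneric f ν) (x : E) :
    ∃ᶠ y in 𝓝 x, y ∉ range f := by
  obtain ⟨v, hv⟩ := exists_sectorDirection (hgen x) ∅
  exact (tendsto_ray x v).frequently
    ((H.eventually_sector (empty_subset _) hv).mono fun s hs => hs.1).frequently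

/-- Local coordinates in which the sheets through `x` are coordinate hyperplanes. -/
theorem exists_straightening (H : IsSheetSystem f ν g a) {x : E}
    (hli : LinearIndependent ℝ (fun q : f ⁻¹' {x} => ν q)) :
    ∃ e : OpenPartialHomeomorph E ((f ⁻¹' {x} → ℝ) ×
        (ContinuousLinearMap.pi (fun q : f ⁻¹' {x} => innerSL ℝ (ν q))).ker),
      x ∈ e.source ∧ e x = 0 ∧ ∀ y, (e y).1 = fun q : f ⁻¹' {x} => g q y := by
  have : Fintype (f ⁻¹' {x}) := (H.finite x).fintype
  have hd : HasStrictFDerivAt (fun y => fun q : f ⁻¹' {x} => g q y)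
      (ContinuousLinearMap.pi (fun q : f ⁻¹' {x} => innerSL ℝ (ν q))) x := by
    rw [hasStrictFDerivAt_pi]
    intro q
    have h2 : f q = x := q.2
    simpa [h2] using H.deriv q
  have hs : (ContinuousLinearMap.pi (fun q : f ⁻¹' {x} => innerSL ℝ (ν q))).range = ⊤ := by
    rw [LinearMap.range_eq_top]
    intro c
    obtain ⟨v, hv⟩ := hli.exists_inner_eq c
    exact ⟨v, funext fun i => by simpa using hv i⟩
  refine ⟨hd.implicitToOpenPartialHomeomorph _ _ hs,
    hd.mem_implicitToOpenPartialHomeomorph_source hs, ?_,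
    fun y => hd.implicitToOpenPartialHomeomorph_fst hs y⟩
  rw [hd.implicitToOpenPartialHomeomorph_self hs]
  refine Prod.ext (funext fun q => ?_) rfl
  have h2 : f q = x := q.2
  simpa [h2] using H.zero q

end IsSheetSystem

end Static

/-! ### Uniqueness of the Alexander numbering and the index of a multiple point -/

theorem Finset.sum_powerset_const_add_card {ι : Type*} (s : Finset ι) (A : ℝ) :
    ∑ T ∈ s.powerset, (A + (T.card : ℝ)) = (A + (s.card : ℝ) / 2) * 2 ^ s.card := by
  classical
  induction s using Finset.induction generalizing A with
  | empty => simp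
  | insert x s hx ih =>
    rw [Finset.sum_powerset_insert hx, ih, Finset.card_insert_of_notMem hx]
    have : ∑ T ∈ s.powerset, (A + ((insert x T).card : ℝ)) =
        ∑ T ∈ s.powerset, (A + 1 + (T.card : ℝ)) := by
      refine Finset.sum_congr rfl fun T hT => ?_
      rw [Finset.card_insert_of_notMem (fun h => hx (Finset.mem_powerset.1 hT h))]
      push_cast; ring
    rw [this, ih]
    push_cast; ring

theorem eventually_eventually_nhds_cocompact {E : Type*} [TopologicalSpace E] [T2Space E]
    {P : E → Prop} (h : ∀ᶠ y in cocompact E, P y) : ∀ᶠ y in cocompact E, ∀ᶠ z in 𝓝 y, P z := by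
  obtain ⟨K, hK, hKP⟩ := mem_cocompact.1 h
  filter_upwards [hK.compl_mem_cocompact] with y hy
  exact Filter.mem_of_superset (hK.isClosed.isOpen_compl.mem_nhds hy) hKP

namespace IsSheetSystem

section Difference

variable {E X : Type*} [TopologicalSpace E] {f : X → E} {a : E → ℝ}

/-- The points near which two functions `a`, `α` differ by the constant `d` off the image of `f`. -/
def differenceSet (f : X → E) (a α : E → ℝ) (d : ℝ) : Set E :=
  {y | ∀ᶠ y' in 𝓝 y, y' ∉ range f → α y' - a y' = d}

theorem sub_eq_of_mem_differenceSet {α : E → ℝ} {y : E} {d : ℝ} (h : y ∈ differenceSet f a α d)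
    (hy : y ∉ range f) : α y - a y = d :=
  Filter.Eventually.self_of_nhds h hy

end Difference

variable {E : Type*} [NormedAddCommGroup E] [InnerProductSpace ℝ E]
  {X : Type*} {f ν : X → E} {g : X → E → ℝ} {a : E → ℝ}

theorem mem_differenceSet {c c' : ℝ} {α : E → ℝ} (hα : IsAlexanderNumbering c f ν α)
    (ha : IsAlexanderNumbering c' f ν a) (y : E) (hy : y ∉ range f) :
    y ∈ differenceSet f a α (α y - a y) := by
  change ∀ᶠ y' in 𝓝 y, y' ∉ range f → α y' - a y' = α y - a y
  filter_upwards [hα.locally_constant y hy, ha.locally_constant y hy] with z h1 h2 _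
  rw [h1, h2]

variable [FiniteDimensional ℝ E]

theorem differenceSet_inj (H : IsSheetSystem f ν g a) (hgen : IsGeneric f ν) {α : E → ℝ} {y : E}
    {d d' : ℝ} (h : y ∈ differenceSet f a α d) (h' : y ∈ differenceSet f a α d') : d = d' := by
  obtain ⟨z, hz, h1, h2⟩ := ((H.frequently_notMem_range hgen y).and_eventually
    (Filter.Eventually.and h h')).exists
  exact (h1 hz).symm.trans (h2 hz)

theorem mem_differenceSet_of_isPreconnected (H : IsSheetSystem f ν g a) (hgen : IsGeneric f ν)
    {α : E → ℝ} {S : Set E} (hS : IsPreconnected S) (hd : ∀ y ∈ S, ∃ d, y ∈ differenceSet f a α d)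
    ⦃y z : E⦄ ⦃d : ℝ⦄ (hy : y ∈ S) (hz : z ∈ S) (hyd : y ∈ differenceSet f a α d) :
    z ∈ differenceSet f a α d := by
  refine (hS.induction₂
    (fun y z => ∀ d, y ∈ differenceSet f a α d ↔ z ∈ differenceSet f a α d) ?_ ?_ ?_ hy hz d).1 hyd
  · intro y hy
    obtain ⟨d₀, h0⟩ := hd y hy
    filter_upwards [nhdsWithin_le_nhds (eventually_eventually_nhds.2 h0)] with z hz d
    exact ⟨fun h => H.differenceSet_inj hgen h h0 ▸ hz,
      fun h => H.differenceSet_inj hgen h hz ▸ h0⟩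
  · intro x y z _ _ _ h1 h2 d; rw [h1, h2]
  · intro x y _ _ h d; rw [h]

/-- At a simple point the two sides of the sheet are connected, and the jump across the sheet is
prescribed, so that the difference of two Alexander numberings is the same on both sides. -/
theorem exists_mem_differenceSet_of_subsingleton (H : IsSheetSystem f ν g a)
    (hgen : IsGeneric f ν) {c c' : ℝ} {α : E → ℝ} (hα : IsAlexanderNumbering c f ν α)
    (ha : IsAlexanderNumbering c' f ν a) {y : E} (hsub : (f ⁻¹' {y}).Subsingleton) :
    ∃ d, y ∈ differenceSet f a α d := by
  by_cases hy : y ∉ range f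
  · exact ⟨_, mem_differenceSet hα ha y hy⟩
  obtain ⟨q, rfl⟩ := not_not.1 hy
  have hq : f ⁻¹' {f q} = {q} := hsub.eq_singleton_of_mem rfl
  obtain ⟨e, hes, he0, he⟩ := H.exists_straightening (hgen (f q))
  have : Fintype (f ⁻¹' {f q}) := (H.finite (f q)).fintype
  have hU : {u | u ∈ e.target ∧ ((e.symm u) ∈ range f ↔ ∃ p, f p = f q ∧ g p (e.symm u) = 0)}
      ∈ 𝓝 (0 : (f ⁻¹' {f q} → ℝ) × _) := by
    have h0 : (0 : (f ⁻¹' {f q} → ℝ) × _) ∈ e.target := he0 ▸ e.map_source hes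
    have h1 : Tendsto e.symm (𝓝 0) (𝓝 (f q)) := by
      have := (e.continuousAt_symm h0).tendsto
      rwa [← he0, e.left_inv hes, he0] at this
    exact inter_mem (e.open_target.mem_nhds h0) (h1.eventually (H.eventually_mem_range (f q)))
  obtain ⟨r, hr, hball⟩ := Metric.mem_nhds_iff.1 hU
  let q' : f ⁻¹' {f q} := ⟨q, rfl⟩
  -- the two sides of the sheet are the half balls `0 < u q'` and `u q' < 0`
  have hval : ∀ u ∈ Metric.ball (0 : (f ⁻¹' {f q} → ℝ) × _) r, u.1 q' = g q (e.symm u) := by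
    intro u hu
    have := congrFun (he (e.symm u)) q'
    rw [e.right_inv (hball hu).1] at this
    exact this
  have hoff : ∀ u ∈ Metric.ball (0 : (f ⁻¹' {f q} → ℝ) × _) r, u.1 q' ≠ 0 →
      e.symm u ∉ range f := by
    intro u hu h0 hmem
    obtain ⟨p, hp, hgp⟩ := (hball hu).2.1 hmem
    have : p = q := hsub hp rfl
    have hgq : g p (e.symm u) = g q (e.symm u) := by rw [this]
    exact h0 ((hval u hu).trans (hgq.symm.trans hgp))
  have hcont : ContinuousOn e.symm (Metric.ball 0 r) :=
    e.continuousOn_symm.mono fun u hu => (hball hu).1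
  have hlin : IsLinearMap ℝ (fun u : (f ⁻¹' {f q} → ℝ) ×
      (ContinuousLinearMap.pi (fun q : f ⁻¹' {f q} => innerSL ℝ (ν q))).ker => u.1 q') :=
    ⟨fun _ _ => rfl, fun _ _ => rfl⟩
  have hpos : IsPreconnected (e.symm '' (Metric.ball 0 r ∩ {u | 0 < u.1 q'})) :=
    ((convex_ball _ _).inter (convex_halfSpace_gt hlin 0)).isPreconnected.image _
      (hcont.mono inter_subset_left)
  have hneg : IsPreconnected (e.symm '' (Metric.ball 0 r ∩ {u | u.1 q' < 0})) :=
    ((convex_ball _ _).inter (convex_halfSpace_lt hlin 0)).isPreconnected.image _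
      (hcont.mono inter_subset_left)
  have hpos' := H.mem_differenceSet_of_isPreconnected hgen hpos (by
    rintro _ ⟨u, hu, rfl⟩; exact ⟨_, mem_differenceSet hα ha _ (hoff u hu.1 (ne_of_gt hu.2))⟩)
  have hneg' := H.mem_differenceSet_of_isPreconnected hgen hneg (by
    rintro _ ⟨u, hu, rfl⟩; exact ⟨_, mem_differenceSet hα ha _ (hoff u hu.1 (ne_of_lt hu.2))⟩)
  have hnear : ∀ᶠ z in 𝓝 (f q),
      (0 < g q z → z ∈ e.symm '' (Metric.ball 0 r ∩ {u | 0 < u.1 q'})) ∧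
      (g q z < 0 → z ∈ e.symm '' (Metric.ball 0 r ∩ {u | u.1 q' < 0})) := by
    have h1 := (e.continuousAt hes).tendsto
    rw [he0] at h1
    filter_upwards [h1 (Metric.ball_mem_nhds 0 hr), e.open_source.mem_nhds hes] with z hz hzs
    have hz' := congrFun (he z) q'
    exact ⟨fun h => ⟨e z, ⟨hz, show 0 < (e z).1 q' from h.trans_eq hz'.symm⟩, e.left_inv hzs⟩,
      fun h => ⟨e z, ⟨hz, show (e z).1 q' < 0 from hz'.trans_lt h⟩, e.left_inv hzs⟩⟩
  have hν : ν q ≠ 0 := (hgen (f q)).ne_zero q'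
  have hνν : 0 < inner ℝ (ν q) (ν q) := real_inner_self_pos.2 hν
  -- a point on either side, where the jump of both numberings is known
  obtain ⟨s, hcα, hcβ, hs1, hs2, hs3, hs4⟩ := ((hα.crossing q hq).and
    ((ha.crossing q hq).and ((H.eventually_pos q hνν).and
    ((H.eventually_neg q (v := -ν q) (by rw [inner_neg_right]; linarith)).and
    (((tendsto_ray (f q) (ν q)).eventually hnear).and
    ((tendsto_ray (f q) (-ν q)).eventually hnear)))))).exists
  have hp := hs3.1 hs1
  have hn := hs4.2 hs2
  rw [smul_neg, ← sub_eq_add_neg] at hn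
  have hp_off : f q + s • ν q ∉ range f := by
    obtain ⟨u, hu, hu'⟩ := hp; rw [← hu']; exact hoff u hu.1 (ne_of_gt hu.2)
  have hn_off : f q - s • ν q ∉ range f := by
    obtain ⟨u, hu, hu'⟩ := hn; rw [← hu']; exact hoff u hu.1 (ne_of_lt hu.2)
  have hd : α (f q - s • ν q) - a (f q - s • ν q) = α (f q + s • ν q) - a (f q + s • ν q) := by
    rw [hcα, hcβ]; ring
  have hpA := mem_differenceSet hα ha _ hp_off
  have hnA := mem_differenceSet hα ha _ hn_off
  rw [hd] at hnA
  refine ⟨α (f q + s • ν q) - a (f q + s • ν q), ?_⟩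
  change ∀ᶠ y' in 𝓝 (f q), y' ∉ range f → _
  filter_upwards [hnear, H.eventually_mem_range (f q)] with z hz hzr hzo
  rcases lt_trichotomy (g q z) 0 with h | h | h
  · exact sub_eq_of_mem_differenceSet (hneg' hn (hz.2 h) hnA) hzo
  · exact absurd (hzr.2 ⟨q, rfl, h⟩) hzo
  · exact sub_eq_of_mem_differenceSet (hpos' hp (hz.1 h) hpA) hzo

/-- In straightened coordinates the sheets through a point are coordinate hyperplanes. Changing the
coordinates one at a time leads from any sector to any other, through simple points only. -/
theorem exists_mem_differenceSet (H : IsSheetSystem f ν g a)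
    (hgen : IsGeneric f ν) {c c' : ℝ} {α : E → ℝ} (hα : IsAlexanderNumbering c f ν α)
    (ha : IsAlexanderNumbering c' f ν a) (y : E) : ∃ d, y ∈ differenceSet f a α d := by
  classical
  obtain ⟨e, hes, he0, he⟩ := H.exists_straightening (hgen y)
  have : Fintype (f ⁻¹' {y}) := (H.finite y).fintype
  have hU : {u | u ∈ e.target ∧ ((∀ p q, f p = y → f q = y → g p (e.symm u) = 0 →
      g q (e.symm u) = 0 → p = q) → (f ⁻¹' {e.symm u}).Subsingleton)}
      ∈ 𝓝 (0 : (f ⁻¹' {y} → ℝ) × _) := by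
    have h0 : (0 : (f ⁻¹' {y} → ℝ) × _) ∈ e.target := he0 ▸ e.map_source hes
    have h1 : Tendsto e.symm (𝓝 0) (𝓝 y) := by
      have := (e.continuousAt_symm h0).tendsto
      rwa [← he0, e.left_inv hes, he0] at this
    exact inter_mem (e.open_target.mem_nhds h0) (h1.eventually (H.eventually_subsingleton y))
  obtain ⟨r, hr, hball⟩ := Metric.mem_nhds_iff.1 hU
  -- a segment which changes one coordinate only meets at most one hyperplane at a time
  have hseg : ∀ P ∈ Metric.ball (0 : (f ⁻¹' {y} → ℝ) × _) r,
      ∀ Q ∈ Metric.ball (0 : (f ⁻¹' {y} → ℝ) × _) r,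
      (∀ q, P.1 q ≠ Q.1 q → ∀ q', q' ≠ q → P.1 q' = Q.1 q') → (∀ q, P.1 q ≠ 0) →
      ∀ d, e.symm P ∈ differenceSet f a α d → e.symm Q ∈ differenceSet f a α d := by
    intro P hP Q hQ hPQ hP0 d hd
    have hsub : segment ℝ P Q ⊆ Metric.ball 0 r := (convex_ball _ _).segment_subset hP hQ
    refine H.mem_differenceSet_of_isPreconnected hgen ((convex_segment P Q).isPreconnected.image _
      (e.continuousOn_symm.mono fun u hu => (hball (hsub hu)).1)) ?_
      ⟨P, left_mem_segment _ _ _, rfl⟩ ⟨Q, right_mem_segment _ _ _, rfl⟩ hd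
    rintro _ ⟨u, hu, rfl⟩
    refine H.exists_mem_differenceSet_of_subsingleton hgen hα ha ((hball (hsub hu)).2 ?_)
    intro p q hp hq hgp hgq
    by_contra hne
    have hval : ∀ q : f ⁻¹' {y}, u.1 q = g q (e.symm u) := by
      intro q
      have := congrFun (he (e.symm u)) q
      rw [e.right_inv (hball (hsub hu)).1] at this
      exact this
    have hfix : ∀ q : f ⁻¹' {y}, P.1 q = Q.1 q → u.1 q ≠ 0 := by
      intro q hq
      obtain ⟨s, t, _, _, hst, rfl⟩ := hu
      have : (s • P + t • Q).1 q = P.1 q := by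
        simp only [Prod.fst_add, Prod.smul_fst, Pi.add_apply, Pi.smul_apply, ← hq, smul_eq_mul]
        rw [← add_mul, hst, one_mul]
      rw [this]; exact hP0 q
    have h1 : P.1 ⟨p, hp⟩ ≠ Q.1 ⟨p, hp⟩ := fun h => hfix _ h ((hval _).trans hgp)
    exact hfix ⟨q, hq⟩ (hPQ _ h1 _ (fun h => hne (congrArg Subtype.val h).symm))
      ((hval _).trans hgq)
  have hall : ∀ P ∈ Metric.ball (0 : (f ⁻¹' {y} → ℝ) × _) r,
      ∀ Q ∈ Metric.ball (0 : (f ⁻¹' {y} → ℝ) × _) r, (∀ q, P.1 q ≠ 0) → (∀ q, Q.1 q ≠ 0) →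
      ∀ d, e.symm P ∈ differenceSet f a α d → e.symm Q ∈ differenceSet f a α d := by
    intro P hP Q hQ hP0 hQ0 d hd
    -- exchange the coordinates one at a time
    let m : Finset (f ⁻¹' {y}) → (f ⁻¹' {y} → ℝ) ×
        (ContinuousLinearMap.pi (fun q : f ⁻¹' {y} => innerSL ℝ (ν q))).ker :=
      fun S => (fun q => if q ∈ S then Q.1 q else P.1 q, Q.2)
    have hm0 : ∀ S q, (m S).1 q ≠ 0 := by
      intro S q; simp only [m]; split_ifs; exacts [hQ0 q, hP0 q]
    have hmb : ∀ S, m S ∈ Metric.ball (0 : (f ⁻¹' {y} → ℝ) × _) r := by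
      intro S
      rw [mem_ball_zero_iff, Prod.norm_def, max_lt_iff] at hP hQ ⊢
      refine ⟨(pi_norm_lt_iff hr).2 fun q => ?_, hQ.2⟩
      simp only [m]; split_ifs
      exacts [(pi_norm_lt_iff hr).1 hQ.1 q, (pi_norm_lt_iff hr).1 hP.1 q]
    have hmA : ∀ S, e.symm (m S) ∈ differenceSet f a α d := by
      intro S
      induction S using Finset.induction with
      | empty => exact hseg P hP _ (hmb _) (fun q h => absurd (by simp [m]) h) hP0 d hd
      | insert p S hp ih =>
        refine hseg _ (hmb S) _ (hmb _) (fun q hq q' hq' => ?_) (hm0 S) d ih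
        have hqp : q = p := by
          by_contra hqp
          exact hq (by simp [m, Finset.mem_insert, hqp])
        subst hqp
        simp [m, Finset.mem_insert, hq']
    have : m Finset.univ = Q := Prod.ext (funext fun q => by simp [m]) rfl
    rw [← this]; exact hmA _
  have hnear : ∀ᶠ z in 𝓝 y, z ∉ range f →
      ∃ P ∈ Metric.ball (0 : (f ⁻¹' {y} → ℝ) × _) r, (∀ q, P.1 q ≠ 0) ∧ e.symm P = z := by
    have h1 := (e.continuousAt hes).tendsto
    rw [he0] at h1
    filter_upwards [h1 (Metric.ball_mem_nhds 0 hr), e.open_source.mem_nhds hes,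
      H.eventually_mem_range y] with z hz hzs hzr hzo
    refine ⟨e z, hz, fun q h0 => hzo (hzr.2 ⟨q, q.2, ?_⟩), e.left_inv hzs⟩
    rw [he z] at h0
    exact h0
  obtain ⟨z, hzo, hz⟩ := ((H.frequently_notMem_range hgen y).and_eventually hnear).exists
  obtain ⟨P, hP, hP0, hPz⟩ := hz hzo
  refine ⟨α z - a z, ?_⟩
  change ∀ᶠ y' in 𝓝 y, y' ∉ range f → _
  filter_upwards [hnear] with w hw hwo
  obtain ⟨Q, hQ, hQ0, hQw⟩ := hw hwo
  have := hall P hP Q hQ hP0 hQ0 (α z - a z) (hPz ▸ mem_differenceSet hα ha z hzo)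
  exact sub_eq_of_mem_differenceSet (hQw ▸ this) hwo

/-- An Alexander numbering is unique off the image: the difference of two of them is locally
constant near every point, multiple points included, and vanishes near infinity. -/
theorem eq_of_isAlexanderNumbering [Nontrivial E] (H : IsSheetSystem f ν g a)
    (hgen : IsGeneric f ν) {c : ℝ} {α : E → ℝ} (hα : IsAlexanderNumbering c f ν α)
    (ha : IsAlexanderNumbering c f ν a) {y : E} (hy : y ∉ range f) : α y = a y := by
  have hnc : NoncompactSpace E := NormedSpace.noncompactSpace ℝ E
  -- a point near infinity
  obtain ⟨z, hz1, hz2⟩ := ((eventually_eventually_nhds_cocompact hα.at_infinity).and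
    (eventually_eventually_nhds_cocompact ha.at_infinity)).exists
  have hzA : z ∈ differenceSet f a α 0 := by
    change ∀ᶠ y' in 𝓝 z, y' ∉ range f → _
    filter_upwards [hz1, hz2] with w h1 h2 _
    rw [h1, h2, sub_self]
  have := sub_eq_of_mem_differenceSet (H.mem_differenceSet_of_isPreconnected hgen
    isPreconnected_univ (fun y _ => H.exists_mem_differenceSet hgen hα ha y) (mem_univ z)
    (mem_univ y) hzA) hy
  linarith

/-- The sectors at a `k`-fold point `x` have the numbers `a x + #T`, where `T` runs over the sets of
sheets through `x`, and the average of `#T` is `k / 2`. -/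
theorem pointIndex_eq (H : IsSheetSystem f ν g a) {α : E → ℝ}
    (hα : ∀ y, y ∉ range f → α y = a y) {x : E}
    (hli : LinearIndependent ℝ (fun q : f ⁻¹' {x} => ν q)) :
    pointIndex α f ν x = a x + ((f ⁻¹' {x}).ncard : ℝ) / 2 := by
  have h1 : ∀ T : Set X, T ⊆ f ⁻¹' {x} → sectorValue α f ν x T = a x + T.ncard := by
    intro T hT
    have hv := Classical.epsilon_spec (exists_sectorDirection hli T)
    refine Tendsto.limUnder_eq (tendsto_const_nhds.congr' ?_)
    filter_upwards [H.eventually_sector hT hv] with s hs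
    exact hs.2.symm.trans (hα _ hs.1).symm
  have h2 : ∑ᶠ (T : Set X) (_ : T ⊆ f ⁻¹' {x}), sectorValue α f ν x T =
      ∑ᶠ (T : Set X) (_ : T ⊆ f ⁻¹' {x}), (a x + (T.ncard : ℝ)) :=
    finsum_congr fun T => finsum_congr fun hT => h1 T hT
  let s : Finset X := (H.finite x).toFinset
  have hs : (s : Set X) = f ⁻¹' {x} := (H.finite x).coe_toFinset
  have hbij : BijOn (fun T : Finset X => (T : Set X)) (s.powerset : Set (Finset X))
      {T : Set X | T ⊆ f ⁻¹' {x}} := by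
    refine ⟨fun T hT => ?_, fun T _ T' _ h => Finset.coe_injective h, fun T hT => ?_⟩
    · change (T : Set X) ⊆ f ⁻¹' {x}
      rw [← hs]; exact_mod_cast Finset.mem_powerset.1 (Finset.mem_coe.1 hT)
    · have hT : T ⊆ f ⁻¹' {x} := hT
      refine ⟨((H.finite x).subset hT).toFinset, ?_, by simp⟩
      simp only [Finset.mem_coe, Finset.mem_powerset, ← Finset.coe_subset, hs, Finite.coe_toFinset]
      exact hT
  have h3 : ∑ᶠ (T : Set X) (_ : T ⊆ f ⁻¹' {x}), (a x + (T.ncard : ℝ)) =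
      ∑ T ∈ s.powerset, (a x + (T.card : ℝ)) := by
    rw [← finsum_mem_coe_finset]
    exact (finsum_mem_eq_of_bijOn _ hbij fun T _ => by simp).symm
  rw [pointIndex, h2, h3, Finset.sum_powerset_const_add_card, ← ncard_coe_finset, hs]
  field_simp

theorem pointIndex_alexander [Nontrivial E] (H : IsSheetSystem f ν g a)
    (hgen : IsGeneric f ν) {c : ℝ} (hc : ∀ᶠ y in cocompact E, a y = c) (x : E) :
    pointIndex (alexander c f ν) f ν x = a x + ((f ⁻¹' {x}).ncard : ℝ) / 2 :=
  have ha := H.isAlexanderNumbering hgen hc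
  H.pointIndex_eq (fun _ hy => H.eq_of_isAlexanderNumbering hgen
    (Classical.epsilon_spec ⟨a, ha⟩) ha hy) (hgen x)

end IsSheetSystem

/-! ### Families of sheets and numberings on space-time -/

theorem isPreconnected_annulus {E : Type*} [NormedAddCommGroup E] [NormedSpace ℝ E]
    (hE : 1 < Module.rank ℝ E) {r R : ℝ} (hr : 0 ≤ r) :
    IsPreconnected {x : E | r < ‖x‖ ∧ ‖x‖ < R} := by
  have h : {x : E | r < ‖x‖ ∧ ‖x‖ < R} =
      (fun q : ℝ × E => q.1 • q.2) '' (Ioo r R ×ˢ Metric.sphere 0 1) := by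
    ext x
    constructor
    · intro hx
      have h0 : ‖x‖ ≠ 0 := (hr.trans_lt hx.1).ne'
      exact ⟨(‖x‖, ‖x‖⁻¹ • x), ⟨hx, by simp [norm_smul, h0]⟩, by simp [smul_smul, h0]⟩
    · rintro ⟨⟨s, u⟩, ⟨hs, hu⟩, rfl⟩
      have hu : ‖u‖ = 1 := by simpa using hu
      have hs : r < s ∧ s < R := hs
      have : ‖s • u‖ = s := by rw [norm_smul, hu, mul_one, Real.norm_of_nonneg (hr.trans hs.1.le)]
      change r < ‖s • u‖ ∧ ‖s • u‖ < R
      rwa [this]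
  rw [h]
  exact (isPreconnected_Ioo.prod (isPreconnected_sphere hE 0 1)).image _
    (by fun_prop : Continuous fun q : ℝ × E => q.1 • q.2).continuousOn

section Family

variable {E : Type*} [NormedAddCommGroup E] [InnerProductSpace ℝ E]
  {X : ℝ → Type*}

/-- A family of cooriented hypersurfaces `f t`, whose domain `X t` may depend on the time `t`, with
defining functions `g t p` on space-time of the moving sheets.

Near `(t, x)` the family consists of the sheets through `x` at time `t`: the points of the
hypersurface at `z = (s, y)` correspond, under `β`, to the sheets `p` with `g t p z = 0`. The
defining functions attached to corresponding points agree in sign. The domains `X t` need no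
topology: all that matters is recorded in `β`. -/
structure IsSheetFamily (I : Set ℝ) (f ν : ∀ t, X t → E) (g : ∀ t, X t → ℝ × E → ℝ) : Prop where
  isOpen : IsOpen I
  finite : ∀ t ∈ I, ∀ x, (f t ⁻¹' {x}).Finite
  deriv : ∀ t ∈ I, ∀ p, ∃ L : ℝ × E →L[ℝ] ℝ, HasStrictFDerivAt (g t p) L (t, f t p) ∧
    ∀ v, L (0, v) = inner ℝ (ν t p) v
  zero : ∀ t ∈ I, ∀ p, g t p (t, f t p) = 0
  near : ∀ t ∈ I, ∀ x, ∀ᶠ z in 𝓝 (t, x), ∃ β : f z.1 ⁻¹' {z.2} → f t ⁻¹' {x},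
    Function.Injective β ∧ (∀ p, p ∈ range β ↔ g t p z = 0) ∧
      ∀ p' : f z.1 ⁻¹' {z.2}, ∀ᶠ w in 𝓝 z, (0 < g z.1 p' w ↔ 0 < g t (β p') w)
  bounded : ∃ R, ∀ t ∈ I, ∀ p, ‖f t p‖ ≤ R

namespace IsSheetFamily

variable {I : Set ℝ} {f ν : ∀ t, X t → E} {g : ∀ t, X t → ℝ × E → ℝ}

/-- The sheets through `z` on whose positive side `w` lies. -/
def positiveSheets (f : ∀ t, X t → E) (g : ∀ t, X t → ℝ × E → ℝ) (z w : ℝ × E) : Set (X z.1) :=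
  {p | f z.1 p = z.2 ∧ 0 < g z.1 p w}

/-- Strict differentiability at a point gives continuity nearby. -/
theorem eventually_continuousAt (H : IsSheetFamily I f ν g) {t : ℝ} (ht : t ∈ I) (p : X t) :
    ∀ᶠ z in 𝓝 (t, f t p), ContinuousAt (g t p) z := by
  obtain ⟨L, hL, _⟩ := H.deriv t ht p
  obtain ⟨K, s, hs, hK⟩ := hL.exists_lipschitzOnWith
  filter_upwards [eventually_eventually_nhds.2 hs] with z hz
  exact hK.continuousOn.continuousAt hz

/-- When the base point moves from `z` to a nearby `w`, the numbers of positive sheets change by a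
constant: a sheet through `z` which misses `w` has a fixed sign near `w`, and the others are the
sheets through `w`. -/
theorem eventually_ncard_positiveSheets (H : IsSheetFamily I f ν g) {t : ℝ} (ht : t ∈ I) (x : E) :
    ∀ᶠ w in 𝓝 (t, x), ∀ᶠ w' in 𝓝 w, ((positiveSheets f g (t, x) w').ncard : ℝ) =
      (positiveSheets f g (t, x) w).ncard + (positiveSheets f g w w').ncard := by
  have hc : ∀ᶠ w in 𝓝 (t, x), ∀ p ∈ f t ⁻¹' {x}, ContinuousAt (g t p) w := by
    rw [(H.finite t ht x).eventually_all]
    intro p hp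
    have hp : f t p = x := hp
    exact hp ▸ H.eventually_continuousAt ht p
  filter_upwards [hc, H.near t ht x] with w hcw ⟨β, hβi, hβr, hβs⟩
  have hpos : ∀ᶠ w' in 𝓝 w, ∀ p ∈ f t ⁻¹' {x}, (0 < g t p w → 0 < g t p w') ∧
      (g t p w < 0 → g t p w' < 0) := by
    rw [(H.finite t ht x).eventually_all]
    intro p hp
    refine Filter.Eventually.and ?_ ?_
    · by_cases h : 0 < g t p w
      · filter_upwards [(hcw p hp).eventually (lt_mem_nhds h)] with w' hw' _ using hw'
      · exact .of_forall fun _ h' => absurd h' h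
    · by_cases h : g t p w < 0
      · filter_upwards [(hcw p hp).eventually (gt_mem_nhds h)] with w' hw' _ using hw'
      · exact .of_forall fun _ h' => absurd h' h
  have hfin : Finite (f w.1 ⁻¹' {w.2}) := by
    have : Finite (f t ⁻¹' {x}) := H.finite t ht x
    exact Finite.of_injective β hβi
  have hsign : ∀ᶠ w' in 𝓝 w, ∀ p' : f w.1 ⁻¹' {w.2}, (0 < g w.1 p' w' ↔ 0 < g t (β p') w') :=
    eventually_all.2 hβs
  filter_upwards [hpos, hsign] with w' hw' hs
  let j : f w.1 ⁻¹' {w.2} → X t := fun p => β p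
  have hj : Function.Injective j := Subtype.val_injective.comp hβi
  let P : Set (f w.1 ⁻¹' {w.2}) := {p | 0 < g w.1 p w'}
  have hP : positiveSheets f g w w' = Subtype.val '' P := by
    ext p
    constructor
    · exact fun ⟨hp, h⟩ => ⟨⟨p, hp⟩, h, rfl⟩
    · rintro ⟨p', h, rfl⟩; exact ⟨p'.2, h⟩
  have hU : positiveSheets f g (t, x) w' = positiveSheets f g (t, x) w ∪ j '' P := by
    ext p
    constructor
    · rintro ⟨hp, h⟩
      rcases lt_trichotomy (g t p w) 0 with h0 | h0 | h0
      · exact absurd h ((hw' p hp).2 h0).not_gt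
      · obtain ⟨p', hp'⟩ := (hβr ⟨p, hp⟩).2 h0
        refine Or.inr ⟨p', (hs p').2 ?_, congrArg Subtype.val hp'⟩
        rw [hp']; exact h
      · exact Or.inl ⟨hp, h0⟩
    · rintro (⟨hp, h⟩ | ⟨p', h, rfl⟩)
      · exact ⟨hp, (hw' p hp).1 h⟩
      · exact ⟨(β p').2, (hs p').1 h⟩
  have hdisj : Disjoint (positiveSheets f g (t, x) w) (j '' P) := by
    rw [Set.disjoint_left]
    rintro p ⟨_, h⟩ ⟨p', _, rfl⟩
    exact h.ne' ((hβr _).1 (mem_range_self p'))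
  have hfin1 : (positiveSheets f g (t, x) w).Finite := (H.finite t ht x).subset fun p hp => hp.1
  rw [hU, ncard_union_eq hdisj hfin1 ((toFinite P).image _), hP, ncard_image_of_injective _ hj,
    ncard_image_of_injective _ Subtype.val_injective]
  push_cast; rfl

variable [FiniteDimensional ℝ E]

/-- Alexander numberings of all members of the family near `t₀` at once, as one function on
space-time. -/
theorem exists_numbering (H : IsSheetFamily I f ν g) (hE : 1 < Module.rank ℝ E) {t₀ : ℝ}
    (ht₀ : t₀ ∈ I) : ∃ a : ℝ × E → ℝ, ∀ᶠ t in 𝓝 t₀,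
      (∀ x, ∀ᶠ w in 𝓝 (t, x), a w = a (t, x) + (positiveSheets f g (t, x) w).ncard) ∧
      ∀ᶠ y in cocompact E, a (t, y) = 0 := by
  obtain ⟨R', hR'⟩ := H.bounded
  obtain ⟨R, hR0, hR⟩ : ∃ R, 0 ≤ R ∧ ∀ t ∈ I, ∀ p, ‖f t p‖ ≤ R :=
    ⟨max R' 0, le_max_right _ _, fun t ht p => (hR' t ht p).trans (le_max_left _ _)⟩
  obtain ⟨δ, hδ, hδI⟩ := Metric.nhds_basis_closedBall.mem_iff.1 (H.isOpen.mem_nhds ht₀)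
  let K : Set (ℝ × E) := Metric.closedBall t₀ δ ×ˢ Metric.closedBall 0 (R + 2)
  have hK : IsCompact K := (isCompact_closedBall _ _).prod (isCompact_closedBall _ _)
  have hKc : Convex ℝ K := (convex_closedBall _ _).prod (convex_closedBall _ _)
  obtain ⟨a, ha⟩ := exists_primitive_of_germ_cocycle hK hKc
    (fun z w => ((positiveSheets f g z w).ncard : ℝ))
    (fun z hz => H.eventually_ncard_positiveSheets (hδI hz.1) z.2)
  have hKn : ∀ t ∈ Metric.ball t₀ δ, ∀ x : E, ‖x‖ < R + 2 → ∀ᶠ w in 𝓝 (t, x), w ∈ K := by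
    intro t ht x hx
    exact prod_mem_nhds (Metric.closedBall_mem_nhds_of_mem ht)
      (Metric.closedBall_mem_nhds_of_mem (by simpa using hx))
  have ha' : ∀ t ∈ Metric.ball t₀ δ, ∀ x : E, ‖x‖ < R + 2 →
      ∀ᶠ w in 𝓝 (t, x), a w = a (t, x) + (positiveSheets f g (t, x) w).ncard := by
    intro t ht x hx
    filter_upwards [hKn t ht x hx, ha (t, x) (hKn t ht x hx).self_of_nhds] with w h1 h2
    exact h2 h1
  have hempty : ∀ t ∈ I, ∀ x : E, R < ‖x‖ → ∀ w, positiveSheets f g (t, x) w = ∅ := by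
    intro t ht x hx w
    ext p
    simp only [mem_empty_iff_false, iff_false]
    rintro ⟨hp, _⟩
    exact (hR t ht p).not_gt (by rw [hp]; exact hx)
  let S : Set (ℝ × E) := Metric.ball t₀ δ ×ˢ {x : E | R < ‖x‖ ∧ ‖x‖ < R + 2}
  have hS : IsPreconnected S :=
    (convex_ball _ _).isPreconnected.prod (isPreconnected_annulus hE hR0)
  have hconst : ∃ c, ∀ z ∈ S, a z = c := by
    rcases S.eq_empty_or_nonempty with h | ⟨z₀, hz₀⟩
    · exact ⟨0, by simp [h]⟩
    refine ⟨a z₀, fun z hz => hS.induction₂ (fun z w => a z = a w) ?_ ?_ ?_ hz hz₀⟩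
    · intro z hz
      filter_upwards [nhdsWithin_le_nhds (ha' z.1 hz.1 z.2 hz.2.2)] with w hw
      rw [hw, hempty z.1 (hδI (Metric.ball_subset_closedBall hz.1)) z.2 hz.2.1]
      simp
    · exact fun _ _ _ _ _ _ => Eq.trans
    · exact fun _ _ _ _ => Eq.symm
  obtain ⟨c, hc⟩ := hconst
  -- the primitive is constant where `R < ‖x‖ < R + 2`, hence may be extended to all of space
  have hfar : ∀ z : ℝ × E, z.1 ∈ Metric.ball t₀ δ → R < ‖z.2‖ →
      (if ‖z.2‖ < R + 1 then a z - c else 0) = 0 := by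
    intro z hz1 hz2
    split_ifs with h
    · rw [hc z ⟨hz1, hz2, by linarith⟩, sub_self]
    · rfl
  refine ⟨fun z => if ‖z.2‖ < R + 1 then a z - c else 0, ?_⟩
  filter_upwards [Metric.ball_mem_nhds t₀ hδ] with t ht
  refine ⟨fun x => ?_, ?_⟩
  · by_cases hx : ‖x‖ < R + 1
    · have h1 : ∀ᶠ w : ℝ × E in 𝓝 (t, x), ‖w.2‖ < R + 1 :=
        (isOpen_lt (by fun_prop : Continuous fun w : ℝ × E => ‖w.2‖) continuous_const).mem_nhds hx
      filter_upwards [h1, ha' t ht x (by linarith)] with w h1 h2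
      simp only [h1, hx, if_true, h2]
      ring
    · have hx : R + 1 ≤ ‖x‖ := not_lt.1 hx
      have h1 : ∀ᶠ w : ℝ × E in 𝓝 (t, x), R < ‖w.2‖ :=
        (isOpen_lt continuous_const (by fun_prop : Continuous fun w : ℝ × E => ‖w.2‖)).mem_nhds
          (by change R < ‖x‖; linarith)
      have h2 : ∀ᶠ w : ℝ × E in 𝓝 (t, x), w.1 ∈ Metric.ball t₀ δ :=
        (Metric.isOpen_ball.preimage continuous_fst).mem_nhds ht
      filter_upwards [h1, h2] with w h1 h2
      rw [hfar w h2 h1, hfar (t, x) ht (by change R < ‖x‖; linarith),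
        hempty t (hδI (Metric.ball_subset_closedBall ht)) x (by linarith)]
      simp
  · filter_upwards [(isCompact_closedBall (0 : E) R).compl_mem_cocompact] with y hy
    exact hfar (t, y) ht (by simpa using hy)

omit [FiniteDimensional ℝ E] in
theorem isSheetSystem (H : IsSheetFamily I f ν g) {t : ℝ} (ht : t ∈ I) {a : ℝ × E → ℝ}
    (ha : ∀ x, ∀ᶠ w in 𝓝 (t, x), a w = a (t, x) + (positiveSheets f g (t, x) w).ncard) :
    IsSheetSystem (f t) (ν t) (fun p y => g t p (t, y)) (fun y => a (t, y)) where
  finite := H.finite t ht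
  deriv p := by
    obtain ⟨L, hL, hLν⟩ := H.deriv t ht p
    have h1 := (hasStrictFDerivAt_const t (f t p)).prodMk (hasStrictFDerivAt_id (𝕜 := ℝ) (f t p))
    have h2 : L.comp (ContinuousLinearMap.prod 0 (ContinuousLinearMap.id ℝ E)) =
        innerSL ℝ (ν t p) := by
      ext v; simp [hLν]
    exact h2 ▸ hL.comp (f t p) h1
  zero := H.zero t ht
  near x := by
    have h1 : Tendsto (fun y : E => (t, y)) (𝓝 x) (𝓝 (t, x)) :=
      Continuous.tendsto (by fun_prop) x
    filter_upwards [h1.eventually (H.near t ht x)] with y ⟨β, h1, h2, _⟩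
    exact ⟨β, h1, h2⟩
  count x := by
    have h1 : Tendsto (fun y : E => (t, y)) (𝓝 x) (𝓝 (t, x)) :=
      Continuous.tendsto (by fun_prop) x
    exact h1.eventually (ha x)

end IsSheetFamily
end Family

/-! ### Multiple points in a family -/

namespace IsSheetFamily

variable {E : Type*} [NormedAddCommGroup E] [InnerProductSpace ℝ E]
  {X : ℝ → Type*} {I : Set ℝ} {f ν : ∀ t, X t → E} {g : ∀ t, X t → ℝ × E → ℝ}

/-- Near `(t, x)` the multiplicity of a point is the number of sheets through `x` containing it. -/
theorem eventually_ncard_fiber (H : IsSheetFamily I f ν g) {t : ℝ} (ht : t ∈ I) (x : E) :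
    ∀ᶠ z in 𝓝 (t, x), (f z.1 ⁻¹' {z.2}).ncard = {p | f t p = x ∧ g t p z = 0}.ncard := by
  filter_upwards [H.near t ht x] with z ⟨β, hβi, hβr, _⟩
  have h : {p | f t p = x ∧ g t p z = 0} = (fun p => (β p : X t)) '' univ := by
    ext p
    constructor
    · rintro ⟨hp, h0⟩
      obtain ⟨p', hp'⟩ := (hβr ⟨p, hp⟩).2 h0
      exact ⟨p', mem_univ _, congrArg Subtype.val hp'⟩
    · rintro ⟨p', _, rfl⟩
      exact ⟨(β p').2, (hβr _).1 (mem_range_self p')⟩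
  have hinj : Function.Injective (fun p => (β p : X t)) := Subtype.val_injective.comp hβi
  rw [h, ncard_image_of_injective _ hinj, ncard_univ]
  rfl

variable [FiniteDimensional ℝ E]

/-- The implicit function theorem: `n` transverse sheets through a point of an `n`-dimensional space
meet, nearby in space and time, in exactly one point at a time. -/
theorem exists_intersection (H : IsSheetFamily I f ν g) {t : ℝ} (ht : t ∈ I) {x : E}
    {S : Finset (X t)} (hS : ∀ p ∈ S, f t p = x) (hcard : S.card = Module.finrank ℝ E)
    (hli : LinearIndependent ℝ (fun p : S => ν t p)) :
    ∃ Y : ℝ → E, Tendsto Y (𝓝 t) (𝓝 x) ∧ (∀ᶠ s in 𝓝 t, ∀ p ∈ S, g t p (s, Y s) = 0) ∧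
      ∀ᶠ z in 𝓝 (t, x), (∀ p ∈ S, g t p z = 0) → z.2 = Y z.1 := by
  choose! L hL hLν using H.deriv t ht
  let Φ : ℝ × E → ℝ × (S → ℝ) := fun z => (z.1, fun p => g t p z)
  let Φ' : ℝ × E →L[ℝ] ℝ × (S → ℝ) :=
    (ContinuousLinearMap.fst ℝ ℝ E).prod (ContinuousLinearMap.pi fun p : S => L p)
  have hΦ : HasStrictFDerivAt Φ Φ' (t, x) := by
    refine hasStrictFDerivAt_fst.prodMk ?_
    rw [hasStrictFDerivAt_pi]
    intro p
    have := hL p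
    rwa [hS p p.2] at this
  have hspan : Submodule.span ℝ (range fun p : S => ν t p) = ⊤ :=
    hli.span_eq_top_of_card_eq_finrank' (by simpa using hcard)
  have hinj : Function.Injective Φ' := by
    rw [injective_iff_map_eq_zero]
    rintro ⟨s, v⟩ h
    have hs : s = 0 := congrArg Prod.fst h
    subst hs
    have hv : ∀ p : S, inner ℝ (ν t p) v = 0 := fun p => by
      rw [← hLν p v]; exact congrFun (congrArg Prod.snd h) p
    have hv' : v ∈ (⊤ : Submodule ℝ E)ᗮ := by
      rw [← hspan, Submodule.mem_orthogonal]
      intro u hu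
      induction hu using Submodule.span_induction with
      | mem u hu => obtain ⟨p, rfl⟩ := hu; exact hv p
      | zero => simp
      | add u w _ _ hu hw => rw [inner_add_left, hu, hw, add_zero]
      | smul c u _ hu => rw [inner_smul_left, hu, mul_zero]
    rw [Submodule.top_orthogonal_eq_bot, Submodule.mem_bot] at hv'
    rw [hv']; rfl
  have hfr : Module.finrank ℝ (ℝ × E) = Module.finrank ℝ (ℝ × (S → ℝ)) := by
    simp [Module.finrank_prod, hcard]
  let Ψ : (ℝ × E) ≃L[ℝ] (ℝ × (S → ℝ)) :=
    (LinearEquiv.ofInjectiveOfFinrankEq Φ'.toLinearMap hinj hfr).toContinuousLinearEquiv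
  have hΨ : (Ψ : (ℝ × E) →L[ℝ] (ℝ × (S → ℝ))) = Φ' := by ext v <;> rfl
  rw [← hΨ] at hΦ
  let e := hΦ.toOpenPartialHomeomorph Φ
  have hes : (t, x) ∈ e.source := hΦ.mem_toOpenPartialHomeomorph_source
  have hez : e (t, x) = (t, 0) := by
    refine Prod.ext rfl (funext fun p => ?_)
    have := H.zero t ht p
    rwa [hS p p.2] at this
  have het : ((t, 0) : ℝ × (S → ℝ)) ∈ e.target := hez ▸ e.map_source hes
  have hsymm : Tendsto e.symm (𝓝 (t, 0)) (𝓝 (t, x)) := by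
    have := (e.continuousAt_symm het).tendsto
    rwa [← hez, e.left_inv hes, hez] at this
  have hline : Tendsto (fun s : ℝ => (s, (0 : S → ℝ))) (𝓝 t) (𝓝 (t, 0)) :=
    Continuous.tendsto (by fun_prop) t
  refine ⟨fun s => (e.symm (s, 0)).2, ?_, ?_, ?_⟩
  · exact (continuous_snd.tendsto (t, x)).comp (hsymm.comp hline)
  · filter_upwards [hline.eventually (e.open_target.mem_nhds het)] with s hs p hp
    have h1 : Φ (e.symm (s, 0)) = (s, 0) := e.right_inv hs
    have h2 : (e.symm (s, 0)).1 = s := congrArg Prod.fst h1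
    have h3 := congrFun (congrArg Prod.snd h1) ⟨p, hp⟩
    have h4 : (s, (e.symm (s, 0)).2) = e.symm (s, 0) := Prod.ext h2.symm rfl
    rw [h4]; exact h3
  · filter_upwards [e.open_source.mem_nhds hes] with z hz h0
    have h1 : e z = (z.1, 0) := Prod.ext rfl (funext fun p => h0 p p.2)
    change z.2 = (e.symm (z.1, 0)).2
    rw [← h1, e.left_inv hz]

/-- The sheets through `x` at time `t`. -/
def fiber (H : IsSheetFamily I f ν g) {t : ℝ} (ht : t ∈ I) (x : E) : Finset (X t) :=
  (H.finite t ht x).toFinset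

omit [FiniteDimensional ℝ E] in
theorem mem_fiber (H : IsSheetFamily I f ν g) {t : ℝ} (ht : t ∈ I) {x : E} {p : X t} :
    p ∈ H.fiber ht x ↔ f t p = x := by simp [fiber]

omit [FiniteDimensional ℝ E] in
theorem card_fiber (H : IsSheetFamily I f ν g) {t : ℝ} (ht : t ∈ I) (x : E) :
    (H.fiber ht x).card = (f t ⁻¹' {x}).ncard := (ncard_eq_toFinset_card _ _).symm

/-- Near a point `x` through which any `n` sheets are transverse, the `n`-fold points at times `s`
near `t` correspond to the `n`-element sets of sheets through `x`. -/
theorem exists_branches (H : IsSheetFamily I f ν g) {t : ℝ} (ht : t ∈ I) (x : E)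
    (hli : ∀ S ⊆ H.fiber ht x, S.card = Module.finrank ℝ E →
      LinearIndependent ℝ (fun p : S => ν t p))
    (hgen : ∀ᶠ s in 𝓝[≠] t, IsGeneric (f s) (ν s)) :
    ∃ Y : Finset (X t) → ℝ → E, ∃ W ∈ 𝓝 x,
      (∀ y ∈ W, Module.finrank ℝ E ≤ (f t ⁻¹' {y}).ncard → y = x) ∧
      (∀ S ∈ (H.fiber ht x).powersetCard (Module.finrank ℝ E), Tendsto (Y S) (𝓝 t) (𝓝 x) ∧
        (∀ᶠ s in 𝓝 t, ∀ p ∈ S, g t p (s, Y S s) = 0) ∧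
        ∀ᶠ z in 𝓝 (t, x), (∀ p ∈ S, g t p z = 0) → z.2 = Y S z.1) ∧
      ∀ W' ∈ 𝓝 x, W' ⊆ W → ∀ᶠ s in 𝓝[≠] t, BijOn (fun S => Y S s)
        ((H.fiber ht x).powersetCard (Module.finrank ℝ E))
        (multiplePoints (Module.finrank ℝ E) (f s) ∩ W') := by
  classical
  set n := Module.finrank ℝ E
  have h1 : ∀ S : Finset (X t), ∃ Y : ℝ → E, S ∈ (H.fiber ht x).powersetCard n →
      Tendsto Y (𝓝 t) (𝓝 x) ∧ (∀ᶠ s in 𝓝 t, ∀ p ∈ S, g t p (s, Y s) = 0) ∧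
      ∀ᶠ z in 𝓝 (t, x), (∀ p ∈ S, g t p z = 0) → z.2 = Y z.1 := by
    intro S
    by_cases hS : S ∈ (H.fiber ht x).powersetCard n
    · obtain ⟨hS1, hS2⟩ := Finset.mem_powersetCard.1 hS
      obtain ⟨Y, hY⟩ := H.exists_intersection ht (fun p hp => (H.mem_fiber ht).1 (hS1 hp)) hS2
        (hli S hS1 hS2)
      exact ⟨Y, fun _ => hY⟩
    · exact ⟨0, fun h => absurd h hS⟩
  choose Y hY using h1
  have hzero : ∀ z : ℝ × E, {p | f t p = x ∧ g t p z = 0} =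
      ((H.fiber ht x).filter (fun p => g t p z = 0) : Finset (X t)) := by
    intro z; ext p; simp [H.mem_fiber ht]
  have hY3 : ∀ᶠ z in 𝓝 (t, x), ∀ S ∈ (H.fiber ht x).powersetCard n,
      (∀ p ∈ S, g t p z = 0) → z.2 = Y S z.1 := by
    rw [Finset.eventually_all]
    exact fun S hS => (hY S hS).2.2
  have hboth := (H.eventually_ncard_fiber ht x).and hY3
  obtain ⟨U, hU, W, hW, hUW⟩ := mem_nhds_prod_iff.1 hboth
  have hYt : ∀ S ∈ (H.fiber ht x).powersetCard n, Y S t = x := fun S hS =>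
    ((hY S hS).2.2.self_of_nhds fun p hp => by
      have h := (H.mem_fiber ht).1 ((Finset.mem_powersetCard.1 hS).1 hp)
      have := H.zero t ht p
      rwa [h] at this).symm
  refine ⟨Y, W, hW, fun y hy hn => ?_, hY, fun W' hW' hsub => ?_⟩
  · obtain ⟨h1, h2⟩ := hUW (mk_mem_prod (mem_of_mem_nhds hU) hy)
    rw [h1, hzero, ncard_coe_finset] at hn
    obtain ⟨S, hS1, hS2⟩ := Finset.exists_subset_card_eq hn
    have hS : S ∈ (H.fiber ht x).powersetCard n :=
      Finset.mem_powersetCard.2 ⟨hS1.trans (Finset.filter_subset _ _), hS2⟩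
    rw [← hYt S hS]
    exact h2 S hS fun p hp => (Finset.mem_filter.1 (hS1 hp)).2
  · have hev : ∀ᶠ s in 𝓝 t, ∀ S ∈ (H.fiber ht x).powersetCard n,
        Y S s ∈ W' ∧ ∀ p ∈ S, g t p (s, Y S s) = 0 := by
      rw [Finset.eventually_all]
      exact fun S hS => ((hY S hS).1.eventually hW').and (hY S hS).2.1
    filter_upwards [hgen, nhdsWithin_le_nhds hev, nhdsWithin_le_nhds hU,
      nhdsWithin_le_nhds (H.isOpen.mem_nhds ht)] with s hs hYs hsU hsI
    have hle : ∀ y, (f s ⁻¹' {y}).ncard ≤ n := by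
      intro y
      have : Fintype (f s ⁻¹' {y}) := (H.finite s hsI y).fintype
      have := (hs y).fintype_card_le_finrank
      rwa [ncard_eq_toFinset_card', toFinset_card]
    have hfilter : ∀ S ∈ (H.fiber ht x).powersetCard n,
        (H.fiber ht x).filter (fun p => g t p (s, Y S s) = 0) = S ∧
          (f s ⁻¹' {Y S s}).ncard = n := by
      intro S hS
      have h1 := (hUW (mk_mem_prod hsU (hsub (hYs S hS).1))).1
      rw [hzero, ncard_coe_finset] at h1
      obtain ⟨hS1, hS2⟩ := Finset.mem_powersetCard.1 hS
      have h2 : S ⊆ (H.fiber ht x).filter (fun p => g t p (s, Y S s) = 0) := fun p hp =>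
        Finset.mem_filter.2 ⟨hS1 hp, (hYs S hS).2 p hp⟩
      have h3 := Finset.card_le_card h2
      have h4 := hle (Y S s)
      have h1 : (f s ⁻¹' {Y S s}).ncard = _ := h1
      exact ⟨(Finset.eq_of_subset_of_card_le h2 (by omega)).symm, by omega⟩
    refine ⟨fun S hS => ⟨(hfilter S hS).2, (hYs S hS).1⟩, fun S hS S' hS' h => ?_, ?_⟩
    · simp only at h
      rw [← (hfilter S hS).1, ← (hfilter S' hS').1, h]
    · rintro y ⟨hy, hyW⟩
      obtain ⟨h1, h2⟩ := hUW (mk_mem_prod hsU (hsub hyW))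
      have hy : (f s ⁻¹' {y}).ncard = n := hy
      rw [hzero, ncard_coe_finset] at h1
      have hS : (H.fiber ht x).filter (fun p => g t p (s, y) = 0) ∈
          (H.fiber ht x).powersetCard n :=
        Finset.mem_powersetCard.2 ⟨Finset.filter_subset _ _, h1.symm.trans hy⟩
      exact ⟨_, hS, (h2 _ hS fun p hp => (Finset.mem_filter.1 hp).2).symm⟩

end IsSheetFamily

/-! ### The sum of the indices near a degenerate point -/

namespace IsSheetFamily

variable {E : Type*} [NormedAddCommGroup E] [InnerProductSpace ℝ E] [FiniteDimensional ℝ E]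
  {X : ℝ → Type*} {I : Set ℝ} {f ν : ∀ t, X t → E} {g : ∀ t, X t → ℝ × E → ℝ}

/-- Let the points of multiplicity at least `n` at time `t` be isolated. Then they are finitely
many, and at nearby times all `n`-fold points lie in prescribed disjoint neighbourhoods of them. -/
theorem exists_separated_nhds (H : IsSheetFamily I f ν g) {t : ℝ} (ht : t ∈ I) {n : ℕ}
    (hn : 0 < n) {W : E → Set E} (hW : ∀ x, W x ∈ 𝓝 x)
    (hiso : ∀ x, ∀ y ∈ W x, n ≤ (f t ⁻¹' {y}).ncard → y = x) :
    ∃ Z : Finset E, (∀ x, x ∈ Z ↔ n ≤ (f t ⁻¹' {x}).ncard) ∧ ∃ W' : E → Set E,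
      (∀ x, W' x ∈ 𝓝 x ∧ W' x ⊆ W x) ∧ (Z : Set E).PairwiseDisjoint W' ∧
      ∀ᶠ s in 𝓝 t, multiplePoints n (f s) ⊆ ⋃ x ∈ (Z : Set E), W' x := by
  obtain ⟨R, hR⟩ := H.bounded
  have hball : ∀ s ∈ I, ∀ y, (f s ⁻¹' {y}).ncard ≠ 0 → y ∈ Metric.closedBall (0 : E) R := by
    intro s hs y hy
    obtain ⟨p, hp⟩ := nonempty_of_ncard_ne_zero hy
    have hp : f s p = y := hp
    simpa [← hp] using hR s hs p
  obtain ⟨Z₀, hZ₀, hcover⟩ :=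
    (isCompact_closedBall (0 : E) R).elim_nhds_subcover W fun x _ => hW x
  have hfin : {x | n ≤ (f t ⁻¹' {x}).ncard}.Finite := by
    refine Z₀.finite_toSet.subset fun x hx => ?_
    have hx : n ≤ (f t ⁻¹' {x}).ncard := hx
    obtain ⟨y, hy, hxy⟩ := mem_iUnion₂.1 (hcover (hball t ht x (by omega)))
    rw [hiso y x hxy hx]; exact hy
  obtain ⟨U, hU, hUd⟩ := hfin.t2_separation
  let W' : E → Set E := fun x => interior (W x) ∩ U x
  have hW'o : ∀ x, IsOpen (W' x) := fun x => isOpen_interior.inter (hU x).2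
  refine ⟨hfin.toFinset, fun x => by simp, W', fun x => ⟨(hW'o x).mem_nhds
    ⟨mem_interior_iff_mem_nhds.2 (hW x), (hU x).1⟩, inter_subset_left.trans interior_subset⟩,
    ?_, ?_⟩
  · rw [hfin.coe_toFinset]
    exact hUd.mono fun x => inter_subset_right
  · rw [hfin.coe_toFinset]
    set O := ⋃ x ∈ {x | n ≤ (f t ⁻¹' {x}).ncard}, W' x
    have hO : IsOpen O := isOpen_biUnion fun x _ => hW'o x
    have hK : IsCompact (Metric.closedBall (0 : E) R \ O) :=
      (isCompact_closedBall (0 : E) R).diff hO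
    have hev : ∀ᶠ s in 𝓝 t, ∀ y ∈ Metric.closedBall (0 : E) R \ O, (f s ⁻¹' {y}).ncard ≠ n := by
      refine hK.eventually_forall_of_forall_eventually fun y hy => ?_
      filter_upwards [H.eventually_ncard_fiber ht y] with z hz
      have hlt : (f t ⁻¹' {y}).ncard < n := by
        by_contra h
        exact hy.2 (mem_biUnion (show y ∈ {x | n ≤ (f t ⁻¹' {x}).ncard} from not_lt.1 h)
          ⟨mem_interior_iff_mem_nhds.2 (hW y), (hU y).1⟩)
      have hle : {p | f t p = y ∧ g t p z = 0}.ncard ≤ (f t ⁻¹' {y}).ncard :=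
        ncard_le_ncard (fun p hp => hp.1) (H.finite t ht y)
      rw [hz]; omega
    filter_upwards [hev, H.isOpen.mem_nhds ht] with s hs hsI y hy
    have hy : (f s ⁻¹' {y}).ncard = n := hy
    by_contra hyO
    exact hs y ⟨hball s hsI y (by omega), hyO⟩ hy

/-- The sum of the indices of the `n`-fold points before and after an event at which the only
degeneracy is an `(n + 1)`-fold point `x₀`. It varies with the number of those sheets through `x₀`
on whose positive side the intersection point of the other sheets lies. -/
theorem exists_sum_pointIndex_eq (H : IsSheetFamily I f ν g) {t₀ : ℝ} (ht₀ : t₀ ∈ I)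
    (hE : 1 < Module.finrank ℝ E) (hgen : ∀ᶠ t in 𝓝[≠] t₀, IsGeneric (f t) (ν t)) {x₀ : E}
    (hother : ∀ x, x ≠ x₀ → LinearIndependent ℝ (fun p : f t₀ ⁻¹' {x} => ν t₀ p))
    (hcard : (f t₀ ⁻¹' {x₀}).ncard = Module.finrank ℝ E + 1)
    (hx₀ : ∀ S : Finset (X t₀), (∀ p ∈ S, f t₀ p = x₀) → S.card = Module.finrank ℝ E →
      LinearIndependent ℝ (fun p : S => ν t₀ p))
    {Y : X t₀ → ℝ → E} (hY : ∀ p, f t₀ p = x₀ → Tendsto (Y p) (𝓝 t₀) (𝓝 x₀))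
    (hY' : ∀ p, f t₀ p = x₀ → ∀ q, f t₀ q = x₀ → q ≠ p → ∀ᶠ t in 𝓝 t₀, g t₀ q (t, Y p t) = 0) :
    ∃ C : ℝ → ℝ, ∀ᶠ t in 𝓝[≠] t₀, ∀ c,
      ∑ᶠ x ∈ multiplePoints (Module.finrank ℝ E) (f t),
        pointIndex (alexander c (f t) (ν t)) (f t) (ν t) x =
      C c + ({p | f t₀ p = x₀ ∧ 0 < g t₀ p (t, Y p t)}.ncard : ℝ) := by
  classical
  have : Nontrivial E := Module.nontrivial_of_finrank_pos (R := ℝ) (by omega)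
  have hrank : 1 < Module.rank ℝ E := by
    rw [← Module.finrank_eq_rank]; exact_mod_cast hE
  set n := Module.finrank ℝ E
  have hli : ∀ x, ∀ S ⊆ H.fiber ht₀ x, S.card = n → LinearIndependent ℝ (fun p : S => ν t₀ p) := by
    intro x S hS hSn
    by_cases hx : x = x₀
    · exact hx₀ S (fun p hp => hx ▸ (H.mem_fiber ht₀).1 (hS hp)) hSn
    · exact (hother x hx).comp (fun p : S => ⟨p, (H.mem_fiber ht₀).1 (hS p.2)⟩)
        fun p q h => Subtype.ext (congrArg (fun r : f t₀ ⁻¹' {x} => (r : X t₀)) h)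
  have hle : ∀ x, x ≠ x₀ → (H.fiber ht₀ x).card ≤ n := by
    intro x hx
    have : Fintype (f t₀ ⁻¹' {x}) := (H.finite t₀ ht₀ x).fintype
    have := (hother x hx).fintype_card_le_finrank
    rwa [card_fiber, ncard_eq_toFinset_card', toFinset_card]
  choose B W hW hiso hB hbij using fun x => H.exists_branches ht₀ x (hli x) hgen
  obtain ⟨Z, hZ, W', hW', hdisj, hcover⟩ := H.exists_separated_nhds ht₀ (by omega) hW hiso
  obtain ⟨a, ha⟩ := H.exists_numbering hrank ht₀
  let P : E → Finset (Finset (X t₀)) := fun x => (H.fiber ht₀ x).powersetCard n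
  -- the value of the numbering along the branches
  have hval : ∀ᶠ t in 𝓝 t₀, ∀ x ∈ Z, ∀ S ∈ P x, a (t, B x S t) = a (t₀, x) +
      (positiveSheets f g (t₀, x) (t, B x S t)).ncard := by
    rw [Finset.eventually_all]
    intro x _
    rw [Finset.eventually_all]
    intro S hS
    have h1 : Tendsto (fun t => (t, B x S t)) (𝓝 t₀) (𝓝 (t₀, x)) :=
      tendsto_id.prodMk_nhds (hB x S hS).1
    exact h1.eventually (ha.self_of_nhds.1 x)
  -- the sheets defining a branch pass through it
  have hzero : ∀ᶠ t in 𝓝 t₀, ∀ x ∈ Z, ∀ S ∈ P x, ∀ p ∈ S, g t₀ p (t, B x S t) = 0 := by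
    rw [Finset.eventually_all]
    intro x _
    rw [Finset.eventually_all]
    exact fun S hS => (hB x S hS).2.1
  have hbij' : ∀ᶠ t in 𝓝[≠] t₀, ∀ x ∈ Z, BijOn (fun S => B x S t) (P x)
      (multiplePoints n (f t) ∩ W' x) := by
    rw [Finset.eventually_all]
    exact fun x _ => hbij x _ (hW' x).1 (hW' x).2
  have hYB : ∀ᶠ t in 𝓝 t₀, ∀ p ∈ H.fiber ht₀ x₀,
      Y p t = B x₀ ((H.fiber ht₀ x₀).erase p) t := by
    rw [Finset.eventually_all]
    intro p hp
    have hp' := (H.mem_fiber ht₀).1 hp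
    have hS : (H.fiber ht₀ x₀).erase p ∈ P x₀ := Finset.mem_powersetCard.2
      ⟨Finset.erase_subset _ _, by rw [Finset.card_erase_of_mem hp, card_fiber, hcard]; rfl⟩
    have h1 : Tendsto (fun t => (t, Y p t)) (𝓝 t₀) (𝓝 (t₀, x₀)) :=
      tendsto_id.prodMk_nhds (hY p hp')
    have h2 : ∀ᶠ t in 𝓝 t₀, ∀ q ∈ (H.fiber ht₀ x₀).erase p, g t₀ q (t, Y p t) = 0 := by
      rw [Finset.eventually_all]
      intro q hq
      exact hY' p hp' q ((H.mem_fiber ht₀).1 (Finset.mem_of_mem_erase hq))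
        (Finset.ne_of_mem_erase hq)
    filter_upwards [h1.eventually (hB x₀ _ hS).2.2, h2] with t h1 h2
    exact h1 h2
  refine ⟨fun c => ∑ x ∈ Z, ∑ _S ∈ P x, (a (t₀, x) + c + (n : ℝ) / 2), ?_⟩
  filter_upwards [hgen, hbij', nhdsWithin_le_nhds hcover, nhdsWithin_le_nhds ha,
    nhdsWithin_le_nhds hval, nhdsWithin_le_nhds hzero, nhdsWithin_le_nhds hYB,
    nhdsWithin_le_nhds (H.isOpen.mem_nhds ht₀)]
    with t htgen htbij htcover hta htval htzero htYB ht c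
  have hsys := (H.isSheetSystem ht hta.1).add_const c
  have hinf : ∀ᶠ y in cocompact E, a (t, y) + c = c := by
    filter_upwards [hta.2] with y hy; rw [hy, zero_add]
  have hidx : ∀ x ∈ multiplePoints n (f t),
      pointIndex (alexander c (f t) (ν t)) (f t) (ν t) x = a (t, x) + c + (n : ℝ) / 2 := by
    intro x hx
    have hx : (f t ⁻¹' {x}).ncard = n := hx
    rw [hsys.pointIndex_alexander htgen hinf x, hx]
  have hunion : multiplePoints n (f t) = ⋃ x ∈ (Z : Set E), multiplePoints n (f t) ∩ W' x := by
    rw [← inter_iUnion₂, inter_eq_left.2 htcover]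
  have hfin : ∀ x ∈ (Z : Set E), (multiplePoints n (f t) ∩ W' x).Finite := fun x hx =>
    (htbij x hx).image_eq ▸ (P x).finite_toSet.image _
  rw [finsum_mem_congr rfl hidx, hunion, finsum_mem_biUnion
    (hdisj.mono fun x => inter_subset_right) Z.finite_toSet hfin, finsum_mem_coe_finset]
  have hterm : ∀ x ∈ Z, ∑ᶠ y ∈ multiplePoints n (f t) ∩ W' x, (a (t, y) + c + (n : ℝ) / 2) =
      ∑ S ∈ P x, (a (t₀, x) + c + (n : ℝ) / 2) +
      ∑ S ∈ P x, ((positiveSheets f g (t₀, x) (t, B x S t)).ncard : ℝ) := by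
    intro x hx
    rw [← finsum_mem_eq_of_bijOn _ (htbij x hx) fun S _ => rfl, finsum_mem_coe_finset,
      ← Finset.sum_add_distrib]
    refine Finset.sum_congr rfl fun S hS => ?_
    rw [htval x hx S hS]; ring
  rw [Finset.sum_congr rfl hterm, Finset.sum_add_distrib]
  congr 1
  have hx₀Z : x₀ ∈ Z := (hZ x₀).2 (by omega)
  rw [Finset.sum_eq_single x₀ ?_ (fun h => absurd hx₀Z h)]
  · have hbijP : ∑ S ∈ P x₀, ((positiveSheets f g (t₀, x₀) (t, B x₀ S t)).ncard : ℝ) =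
        ∑ p ∈ H.fiber ht₀ x₀, if 0 < g t₀ p (t, Y p t) then 1 else 0 := by
      symm
      refine Finset.sum_bij (fun p _ => (H.fiber ht₀ x₀).erase p) ?_ ?_ ?_ ?_
      · exact fun p hp => Finset.mem_powersetCard.2 ⟨Finset.erase_subset _ _, by
          rw [Finset.card_erase_of_mem hp, card_fiber, hcard]; rfl⟩
      · exact fun p hp q hq h => (Finset.erase_inj _ hp).1 h
      · intro S hS
        obtain ⟨hS1, hS2⟩ := Finset.mem_powersetCard.1 hS
        have h1 : (H.fiber ht₀ x₀ \ S).card = 1 := by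
          rw [Finset.card_sdiff_of_subset hS1, hS2, card_fiber, hcard]; omega
        obtain ⟨p, hp⟩ := Finset.card_eq_one.1 h1
        have hpm : p ∈ H.fiber ht₀ x₀ \ S := hp ▸ Finset.mem_singleton_self p
        refine ⟨p, (Finset.mem_sdiff.1 hpm).1, ?_⟩
        rw [Finset.erase_eq, ← hp, Finset.sdiff_sdiff_eq_self hS1]
      · intro p hp
        have hS : (H.fiber ht₀ x₀).erase p ∈ P x₀ := Finset.mem_powersetCard.2
          ⟨Finset.erase_subset _ _, by rw [Finset.card_erase_of_mem hp, card_fiber, hcard]; rfl⟩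
        rw [← htYB p hp]
        have hz := htzero x₀ hx₀Z _ hS
        rw [← htYB p hp] at hz
        have hset : positiveSheets f g (t₀, x₀) (t, Y p t) =
            if 0 < g t₀ p (t, Y p t) then {p} else ∅ := by
          ext q
          by_cases hqp : q = p
          · subst hqp
            have := (H.mem_fiber ht₀).1 hp
            by_cases h0 : 0 < g t₀ q (t, Y q t) <;> simp [positiveSheets, this, h0]
          · have h1 : q ∉ positiveSheets f g (t₀, x₀) (t, Y p t) := fun ⟨hq, h0⟩ =>
              h0.ne' (hz q (Finset.mem_erase.2 ⟨hqp, (H.mem_fiber ht₀).2 hq⟩))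
            split_ifs <;> simp [h1, hqp]
        rw [hset]
        split_ifs <;> simp
    rw [hbijP, Finset.sum_boole]
    congr 1
    rw [← ncard_coe_finset]
    congr 1
    ext p; simp [H.mem_fiber ht₀]
  · intro x hx hxx₀
    refine Finset.sum_eq_zero fun S hS => ?_
    obtain ⟨hS1, hS2⟩ := Finset.mem_powersetCard.1 hS
    have hSF : S = H.fiber ht₀ x :=
      Finset.eq_of_subset_of_card_le hS1 (by rw [hS2]; exact hle x hxx₀)
    have : positiveSheets f g (t₀, x) (t, B x S t) = ∅ := by
      ext p
      simp only [mem_empty_iff_false, iff_false]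
      rintro ⟨hp, h0⟩
      exact h0.ne' (htzero x hx S hS p (hSF ▸ (H.mem_fiber ht₀).2 hp))
    simp [this]

end IsSheetFamily

/-! ### The sheets of a regular homotopy -/

section SurfaceFamily

variable {M : Type*} [TopologicalSpace M] [ChartedSpace (EuclideanSpace ℝ (Fin 2)) M]
  [IsManifold (𝓡 2) ∞ M] {f ν : ℝ → M → Space}

namespace IsRegularHomotopy

omit [IsManifold (𝓡 2) ∞ M] in
theorem continuous (hf : IsRegularHomotopy f ν) : Continuous fun z : ℝ × M => f z.1 z.2 :=
  hf.smooth.continuous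

theorem contDiffAt_chart (hf : IsRegularHomotopy f ν) (t : ℝ) (p : M) :
    ContDiffAt ℝ ∞ (fun z : ℝ × EuclideanSpace ℝ (Fin 2) =>
      f z.1 ((chartAt (EuclideanSpace ℝ (Fin 2)) p).symm z.2))
      (t, chartAt (EuclideanSpace ℝ (Fin 2)) p p) := by
  rw [← contMDiffAt_iff_contDiffAt]
  have h1 : ContMDiffAt (𝓡 2) (𝓡 2) ∞ (chartAt (EuclideanSpace ℝ (Fin 2)) p).symm
      (chartAt (EuclideanSpace ℝ (Fin 2)) p p) :=
    contMDiffOn_chart_symm.contMDiffAt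
      ((chartAt (EuclideanSpace ℝ (Fin 2)) p).open_target.mem_nhds (mem_chart_target _ p))
  have h2 : ContMDiffAt 𝓘(ℝ, ℝ × EuclideanSpace ℝ (Fin 2)) (𝓘(ℝ, ℝ).prod (𝓡 2)) ∞
      (fun z : ℝ × EuclideanSpace ℝ (Fin 2) =>
        (z.1, (chartAt (EuclideanSpace ℝ (Fin 2)) p).symm z.2))
      (t, chartAt (EuclideanSpace ℝ (Fin 2)) p p) :=
    contDiff_fst.contMDiff.contMDiffAt.prodMk (h1.comp (t, chartAt (EuclideanSpace ℝ (Fin 2)) p p)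
      contDiff_snd.contMDiff.contMDiffAt)
  exact hf.smooth.contMDiffAt.comp _ h2

theorem fderiv_chart (hf : IsRegularHomotopy f ν) (t : ℝ) (p : M) (w : EuclideanSpace ℝ (Fin 2)) :
    fderiv ℝ (fun z : ℝ × EuclideanSpace ℝ (Fin 2) =>
      f z.1 ((chartAt (EuclideanSpace ℝ (Fin 2)) p).symm z.2))
      (t, chartAt (EuclideanSpace ℝ (Fin 2)) p p) (0, w) =
    (mfderiv (𝓡 2) 𝓘(ℝ, Space) (f t) p (w : TangentSpace (𝓡 2) p) : Space) := by
  have h1 : MDifferentiableAt (𝓡 2) 𝓘(ℝ, Space) (f t) p := by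
    have h2 : ContMDiff (𝓡 2) 𝓘(ℝ, Space) ∞ (f t) :=
      hf.smooth.comp (contMDiff_const.prodMk contMDiff_id : ContMDiff (𝓡 2) (𝓘(ℝ, ℝ).prod (𝓡 2)) ∞
        (fun q : M => (t, q)))
    exact h2.contMDiffAt.mdifferentiableAt (by simp)
  let A : EuclideanSpace ℝ (Fin 2) →L[ℝ] Space := mfderiv (𝓡 2) 𝓘(ℝ, Space) (f t) p
  have h3 : HasFDerivAt (fun u : EuclideanSpace ℝ (Fin 2) =>
      f t ((chartAt (EuclideanSpace ℝ (Fin 2)) p).symm u)) A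
      (chartAt (EuclideanSpace ℝ (Fin 2)) p p) := by
    have := h1.hasMFDerivAt.2
    simp only [extChartAt_model_space_eq_id, writtenInExtChartAt, modelWithCornersSelf_coe,
      range_id] at this
    exact hasFDerivWithinAt_univ.1 this
  have h4 := ((hf.contDiffAt_chart t p).differentiableAt (by simp)).hasFDerivAt
  have h5 : HasFDerivAt (fun u : EuclideanSpace ℝ (Fin 2) => (t, u))
      (ContinuousLinearMap.prod 0 (ContinuousLinearMap.id ℝ _))
      (chartAt (EuclideanSpace ℝ (Fin 2)) p p) :=
    (hasFDerivAt_const t _).prodMk (hasFDerivAt_id _)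
  have h6 := h4.comp (chartAt (EuclideanSpace ℝ (Fin 2)) p p) h5
  exact (DFunLike.congr_fun (h3.unique h6) w).symm

/-- Pushing the moving surface in the direction of its normal at one moment and one point gives, by
the inverse function theorem, local coordinates on space-time. -/
theorem exists_normalCoordinates (hf : IsRegularHomotopy f ν) (t : ℝ) (p : M) :
    ∃ e : OpenPartialHomeomorph (ℝ × M × ℝ) (ℝ × Space), (t, p, 0) ∈ e.source ∧
      (∀ z ∈ e.source, e z = (z.1, f z.1 z.2.1 + z.2.2 • ν t p)) ∧
      ∃ L : ℝ × Space →L[ℝ] ℝ, HasStrictFDerivAt (fun w => (e.symm w).2.2) L (t, f t p) ∧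
        ∀ v, L (0, v) = inner ℝ (ν t p) v := by
  let φ := chartAt (EuclideanSpace ℝ (Fin 2)) p
  let F : ℝ × EuclideanSpace ℝ (Fin 2) → Space := fun z => f z.1 (φ.symm z.2)
  let F' := fderiv ℝ F (t, φ p)
  have hF : HasStrictFDerivAt F F' (t, φ p) :=
    (hf.contDiffAt_chart t p).hasStrictFDerivAt (by simp)
  let G : ℝ × EuclideanSpace ℝ (Fin 2) × ℝ → ℝ × Space :=
    fun z => (z.1, F (z.1, z.2.1) + z.2.2 • ν t p)
  let A := ContinuousLinearMap.fst ℝ ℝ (EuclideanSpace ℝ (Fin 2) × ℝ)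
  let B := (ContinuousLinearMap.fst ℝ (EuclideanSpace ℝ (Fin 2)) ℝ).comp
    (ContinuousLinearMap.snd ℝ ℝ (EuclideanSpace ℝ (Fin 2) × ℝ))
  let C := (ContinuousLinearMap.snd ℝ (EuclideanSpace ℝ (Fin 2)) ℝ).comp
    (ContinuousLinearMap.snd ℝ ℝ (EuclideanSpace ℝ (Fin 2) × ℝ))
  let G' : ℝ × EuclideanSpace ℝ (Fin 2) × ℝ →L[ℝ] ℝ × Space :=
    A.prod (F'.comp (A.prod B) + C.smulRight (ν t p))
  have hG : HasStrictFDerivAt G G' (t, φ p, 0) := by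
    refine A.hasStrictFDerivAt.prodMk (HasStrictFDerivAt.add ?_ ?_)
    · exact HasStrictFDerivAt.comp (g := F) (t, φ p, (0 : ℝ)) hF
        (A.prod B).hasStrictFDerivAt
    · exact (C.smulRight (ν t p)).hasStrictFDerivAt
  have horth : ∀ w, inner ℝ (ν t p) (F' (0, w)) = 0 := fun w => by
    have := hf.normal_orthogonal t p w
    rwa [← hf.fderiv_chart t p w] at this
  have hνν : inner ℝ (ν t p) (ν t p) = (1 : ℝ) := by
    rw [real_inner_self_eq_norm_sq, hf.normal_unit]; norm_num
  -- the last coordinate is recovered by the inner product with the normal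
  have hthird : ∀ u r, inner ℝ (ν t p) (F' (0, u) + r • ν t p) = r := fun u r => by
    rw [inner_add_right, horth, inner_smul_right, hνν]; ring
  have hG'0 : ∀ u r, G' (0, u, r) = (0, F' (0, u) + r • ν t p) := fun u r => rfl
  have hinj : Function.Injective G' := by
    rw [injective_iff_map_eq_zero]
    rintro ⟨s, u, r⟩ h
    have hs : s = 0 := congrArg Prod.fst h
    subst hs
    rw [hG'0] at h
    have h2 : F' (0, u) + r • ν t p = 0 := congrArg Prod.snd h
    have hr : r = 0 := by rw [← hthird u r, h2, inner_zero_right]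
    subst hr
    rw [zero_smul, add_zero] at h2
    have hu : u = 0 := hf.immersion t p
      (((hf.fderiv_chart t p u).symm.trans h2).trans
        (map_zero (mfderiv (𝓡 2) 𝓘(ℝ, Space) (f t) p)).symm)
    rw [hu]; rfl
  have hfr : Module.finrank ℝ (ℝ × EuclideanSpace ℝ (Fin 2) × ℝ) =
      Module.finrank ℝ (ℝ × Space) := by
    simp [Module.finrank_prod]
  let Ψ : (ℝ × EuclideanSpace ℝ (Fin 2) × ℝ) ≃L[ℝ] (ℝ × Space) :=
    (LinearEquiv.ofInjectiveOfFinrankEq G'.toLinearMap hinj hfr).toContinuousLinearEquiv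
  have hΨ : (Ψ : (ℝ × EuclideanSpace ℝ (Fin 2) × ℝ) →L[ℝ] (ℝ × Space)) = G' :=
    ContinuousLinearMap.ext fun _ => rfl
  rw [← hΨ] at hG
  let e₀ := hG.toOpenPartialHomeomorph G
  have he₀s : (t, φ p, (0 : ℝ)) ∈ e₀.source := hG.mem_toOpenPartialHomeomorph_source
  have he₀ : e₀ (t, φ p, 0) = (t, f t p) := by
    change (t, f t (φ.symm (φ p)) + (0 : ℝ) • ν t p) = _
    rw [φ.left_inv (mem_chart_source _ p), zero_smul, add_zero]
  let ψ : OpenPartialHomeomorph (ℝ × M × ℝ) (ℝ × EuclideanSpace ℝ (Fin 2) × ℝ) :=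
    (OpenPartialHomeomorph.refl ℝ).prod (φ.prod (OpenPartialHomeomorph.refl ℝ))
  refine ⟨ψ.trans e₀, ?_, ?_, ?_⟩
  · rw [OpenPartialHomeomorph.trans_source]
    refine ⟨?_, he₀s⟩
    exact ⟨mem_univ _, mem_chart_source _ p, mem_univ _⟩
  · rintro ⟨s, q, r⟩ hz
    rw [OpenPartialHomeomorph.trans_source] at hz
    have hq : q ∈ φ.source := hz.1.2.1
    change (s, f s (φ.symm (φ q)) + r • ν t p) = _
    rw [φ.left_inv hq]
  · have het : (t, f t p) ∈ e₀.target := he₀ ▸ e₀.map_source he₀s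
    have hsymm : e₀.symm (t, f t p) = (t, φ p, 0) := by rw [← he₀, e₀.left_inv he₀s]
    have hd : HasStrictFDerivAt e₀.symm (Ψ.symm : ℝ × Space →L[ℝ] _) (t, f t p) :=
      e₀.hasStrictFDerivAt_symm het (by rw [hsymm]; exact hG)
    have hC : HasStrictFDerivAt (fun w => C (e₀.symm w)) (C.comp (Ψ.symm : ℝ × Space →L[ℝ] _))
        (t, f t p) := C.hasStrictFDerivAt.comp _ hd
    have hfun : (fun w => ((ψ.trans e₀).symm w).2.2) = fun w => C (e₀.symm w) := by
      ext w; rw [OpenPartialHomeomorph.coe_trans_symm]; rfl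
    refine ⟨C.comp (Ψ.symm : ℝ × Space →L[ℝ] _), hfun ▸ hC, fun v => ?_⟩
    obtain ⟨⟨s, u, r⟩, hsur⟩ := Ψ.surjective (0, v)
    have h1 : G' (s, u, r) = (0, v) := hsur
    have hs : s = 0 := congrArg Prod.fst h1
    subst hs
    rw [hG'0] at h1
    have h2 : F' (0, u) + r • ν t p = v := congrArg Prod.snd h1
    rw [← h2, hthird, h2, ← hsur]
    change C (Ψ.symm (Ψ (0, u, r))) = r
    rw [Ψ.symm_apply_apply]
    rfl

/-- Local coordinates `(s, q, r)` on space-time near the sheet through `p` at time `t`, with the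
sheet at `r = 0`. -/
def normalCoordinates (hf : IsRegularHomotopy f ν) (t : ℝ) (p : M) :
    OpenPartialHomeomorph (ℝ × M × ℝ) (ℝ × Space) :=
  (hf.exists_normalCoordinates t p).choose

theorem mem_normalCoordinates_source (hf : IsRegularHomotopy f ν) (t : ℝ) (p : M) :
    (t, p, 0) ∈ (hf.normalCoordinates t p).source :=
  (hf.exists_normalCoordinates t p).choose_spec.1

theorem normalCoordinates_apply (hf : IsRegularHomotopy f ν) (t : ℝ) (p : M) {z : ℝ × M × ℝ}
    (hz : z ∈ (hf.normalCoordinates t p).source) :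
    hf.normalCoordinates t p z = (z.1, f z.1 z.2.1 + z.2.2 • ν t p) :=
  (hf.exists_normalCoordinates t p).choose_spec.2.1 z hz

/-- The defining function of the moving sheet through `p` at time `t`: it vanishes on the sheet and
is positive on its positive side. -/
def sheetFunction (hf : IsRegularHomotopy f ν) (t : ℝ) (p : M) (w : ℝ × Space) : ℝ :=
  ((hf.normalCoordinates t p).symm w).2.2

theorem sheetFunction_deriv (hf : IsRegularHomotopy f ν) (t : ℝ) (p : M) :
    ∃ L : ℝ × Space →L[ℝ] ℝ, HasStrictFDerivAt (hf.sheetFunction t p) L (t, f t p) ∧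
      ∀ v, L (0, v) = inner ℝ (ν t p) v :=
  (hf.exists_normalCoordinates t p).choose_spec.2.2

theorem normalCoordinates_self (hf : IsRegularHomotopy f ν) (t : ℝ) (p : M) :
    hf.normalCoordinates t p (t, p, 0) = (t, f t p) := by
  rw [hf.normalCoordinates_apply t p (hf.mem_normalCoordinates_source t p)]
  simp

theorem mem_normalCoordinates_target (hf : IsRegularHomotopy f ν) (t : ℝ) (p : M) :
    (t, f t p) ∈ (hf.normalCoordinates t p).target :=
  hf.normalCoordinates_self t p ▸
    (hf.normalCoordinates t p).map_source (hf.mem_normalCoordinates_source t p)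

theorem tendsto_normalCoordinates_symm (hf : IsRegularHomotopy f ν) (t : ℝ) (p : M) :
    Tendsto (hf.normalCoordinates t p).symm (𝓝 (t, f t p)) (𝓝 (t, p, 0)) := by
  have h := ((hf.normalCoordinates t p).continuousAt_symm
    (hf.mem_normalCoordinates_target t p)).tendsto
  rwa [← hf.normalCoordinates_self t p,
    (hf.normalCoordinates t p).left_inv (hf.mem_normalCoordinates_source t p),
    hf.normalCoordinates_self t p] at h

theorem sheetFunction_of_mem_source (hf : IsRegularHomotopy f ν) (t : ℝ) (p : M) {s : ℝ} {q : M}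
    (h : (s, q, 0) ∈ (hf.normalCoordinates t p).source) : hf.sheetFunction t p (s, f s q) = 0 := by
  have h1 := hf.normalCoordinates_apply t p h
  simp only [zero_smul, add_zero] at h1
  rw [sheetFunction, ← h1, (hf.normalCoordinates t p).left_inv h]

theorem sheetFunction_self (hf : IsRegularHomotopy f ν) (t : ℝ) (p : M) :
    hf.sheetFunction t p (t, f t p) = 0 :=
  hf.sheetFunction_of_mem_source t p (hf.mem_normalCoordinates_source t p)

theorem eventually_mem_source (hf : IsRegularHomotopy f ν) (t : ℝ) (p : M) :
    ∀ᶠ z : ℝ × M in 𝓝 (t, p), (z.1, z.2, (0 : ℝ)) ∈ (hf.normalCoordinates t p).source := by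
  have h : Tendsto (fun z : ℝ × M => (z.1, z.2, (0 : ℝ))) (𝓝 (t, p)) (𝓝 (t, p, 0)) :=
    Continuous.tendsto (by fun_prop) (t, p)
  exact h.eventually ((hf.normalCoordinates t p).open_source.mem_nhds
    (hf.mem_normalCoordinates_source t p))

theorem eventually_sheetFunction_eq_zero (hf : IsRegularHomotopy f ν) (t : ℝ) (p : M) :
    ∀ᶠ z : ℝ × M in 𝓝 (t, p), hf.sheetFunction t p (z.1, f z.1 z.2) = 0 :=
  (hf.eventually_mem_source t p).mono fun _ h => hf.sheetFunction_of_mem_source t p h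

/-- A point of space-time is its foot point plus a multiple of the normal. -/
theorem eq_normalCoordinates (hf : IsRegularHomotopy f ν) (t : ℝ) (p : M) {w : ℝ × Space}
    (hw : w ∈ (hf.normalCoordinates t p).target) :
    w = (((hf.normalCoordinates t p).symm w).1,
      f ((hf.normalCoordinates t p).symm w).1 ((hf.normalCoordinates t p).symm w).2.1 +
        hf.sheetFunction t p w • ν t p) := by
  have h1 := hf.normalCoordinates_apply t p ((hf.normalCoordinates t p).map_target hw)
  rw [(hf.normalCoordinates t p).right_inv hw] at h1
  exact h1

/-- The defining functions of one sheet at different moments and points have the same sign: at the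
distance `r` from the sheet in the direction `ν t p` the one is `r` and the other `r * k + o(r)`,
with `k` the inner product of the two normals. -/
theorem eventually_sheetFunction_pos_iff (hf : IsRegularHomotopy f ν) {t s : ℝ} {p q : M}
    (hq : (s, q, 0) ∈ (hf.normalCoordinates t p).source) (hν : 0 < inner ℝ (ν s q) (ν t p)) :
    ∀ᶠ w in 𝓝 (s, f s q), (0 < hf.sheetFunction s q w ↔ 0 < hf.sheetFunction t p w) := by
  set e := hf.normalCoordinates t p
  set k : ℝ := inner ℝ (ν s q) (ν t p)
  have heq : e (s, q, 0) = (s, f s q) := by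
    rw [hf.normalCoordinates_apply t p hq]; simp
  have htarget : (s, f s q) ∈ e.target := heq ▸ e.map_source hq
  have hsymm : Tendsto e.symm (𝓝 (s, f s q)) (𝓝 (s, q, 0)) := by
    have h := (e.continuousAt_symm htarget).tendsto
    rwa [← heq, e.left_inv hq, heq] at h
  obtain ⟨L, hL, hLν⟩ := hf.sheetFunction_deriv s q
  have hLo := (hasStrictFDerivAt_iff_isLittleO.1 hL).def (half_pos hν)
  -- the foot point on the sheet
  have hfoot : Tendsto (fun w => ((e.symm w).1, (e.symm w).2.1)) (𝓝 (s, f s q)) (𝓝 (s, q)) :=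
    ((by fun_prop : Continuous fun z : ℝ × M × ℝ => (z.1, z.2.1)).tendsto (s, q, 0)).comp hsymm
  have hfoot' : Tendsto (fun w => ((e.symm w).1, f (e.symm w).1 (e.symm w).2.1)) (𝓝 (s, f s q))
      (𝓝 (s, f s q)) :=
    ((continuous_fst.prodMk hf.continuous).tendsto (s, q)).comp hfoot
  filter_upwards [e.open_target.mem_nhds htarget,
    hfoot.eventually (hf.eventually_sheetFunction_eq_zero s q),
    (tendsto_id.prodMk_nhds hfoot').eventually hLo] with w hw h0 hlo
  have hdiff : w - ((e.symm w).1, f (e.symm w).1 (e.symm w).2.1) =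
      (0, hf.sheetFunction t p w • ν t p) := by
    have h := hf.eq_normalCoordinates t p hw
    have hfst : w.1 = (e.symm w).1 := congrArg Prod.fst h
    have hsnd : w.2 = f (e.symm w).1 (e.symm w).2.1 + hf.sheetFunction t p w • ν t p :=
      congrArg Prod.snd h
    exact Prod.ext (sub_eq_zero.2 hfst) (sub_eq_iff_eq_add'.2 hsnd)
  simp only [id] at hlo
  rw [hdiff, h0, sub_zero, hLν, inner_smul_right, Prod.norm_mk, norm_zero, norm_smul,
    hf.normal_unit, mul_one, max_eq_right (norm_nonneg _), Real.norm_eq_abs, Real.norm_eq_abs,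
    abs_le] at hlo
  change -(k / 2 * _) ≤ _ - _ * k ∧ _ - _ * k ≤ k / 2 * _ at hlo
  constructor
  · intro h
    by_contra hr
    rw [abs_of_nonpos (not_lt.1 hr)] at hlo
    nlinarith [not_lt.1 hr]
  · intro h
    rw [abs_of_pos h] at hlo
    nlinarith

/-- A fibre is compact, and discrete as the surface is immersed. -/
theorem finite_fiber [CompactSpace M] [T2Space M] (hf : IsRegularHomotopy f ν) (t : ℝ)
    (x : Space) :
    (f t ⁻¹' {x}).Finite := by
  have hcont : Continuous (f t) := hf.continuous.comp (by fun_prop : Continuous fun p : M => (t, p))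
  have hK : IsCompact (f t ⁻¹' {x}) := (isClosed_singleton.preimage hcont).isCompact
  obtain ⟨F, hF, hcover⟩ := hK.elim_nhds_subcover
    (fun p => {q | (t, q, (0 : ℝ)) ∈ (hf.normalCoordinates t p).source}) fun p _ =>
      ((by fun_prop : Continuous fun q : M => (t, q, (0 : ℝ))).tendsto p).eventually
        ((hf.normalCoordinates t p).open_source.mem_nhds (hf.mem_normalCoordinates_source t p))
  refine F.finite_toSet.subset fun q hq => ?_
  obtain ⟨p, hp, hpq⟩ := mem_iUnion₂.1 (hcover hq)
  have h1 : f t p = x := hF p hp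
  have h2 : f t q = x := hq
  have h3 := (hf.normalCoordinates t p).injOn (hf.mem_normalCoordinates_source t p) hpq (by
    rw [hf.normalCoordinates_self, hf.normalCoordinates_apply t p hpq]
    simp [h1, h2])
  have : p = q := congrArg (fun z : ℝ × M × ℝ => z.2.1) h3
  exact this ▸ hp

/-- Near a point of space-time the surface consists of the sheets through this point; `V` prescribes
how close to them the parameters are. -/
theorem near_fiber [CompactSpace M] [T2Space M] (hf : IsRegularHomotopy f ν) (t : ℝ) (x : Space)
    {V : M → Set M} (hV : ∀ p, f t p = x → V p ∈ 𝓝 p) :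
    ∀ᶠ z in 𝓝 (t, x), ∃ β : f z.1 ⁻¹' {z.2} → f t ⁻¹' {x}, Function.Injective β ∧
      (∀ p, p ∈ range β ↔ hf.sheetFunction t p z = 0) ∧ (∀ q, (q : M) ∈ V (β q)) ∧
      ∀ q : f z.1 ⁻¹' {z.2}, ∀ᶠ w in 𝓝 z,
        (0 < hf.sheetFunction z.1 q w ↔ 0 < hf.sheetFunction t (β q) w) := by
  have hfin := hf.finite_fiber t x
  obtain ⟨U, hU, hUd⟩ := hfin.t2_separation
  have hgood : ∀ p : M, ∃ T ∈ 𝓝 t, ∃ A : Set M, IsOpen A ∧ (f t p = x → p ∈ A) ∧ A ⊆ U p ∩ V p ∧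
      ∀ s ∈ T, ∀ q ∈ A, (s, q, (0 : ℝ)) ∈ (hf.normalCoordinates t p).source ∧
        0 < inner ℝ (ν s q) (ν t p) := by
    intro p
    by_cases hp : f t p = x
    · have h1 : ∀ᶠ z : ℝ × M in 𝓝 (t, p), 0 < inner ℝ (ν z.1 z.2) (ν t p) := by
        have hc : Continuous fun z : ℝ × M => (inner ℝ (ν z.1 z.2) (ν t p) : ℝ) :=
          hf.normal_continuous.inner continuous_const
        refine (hc.tendsto (t, p)).eventually (lt_mem_nhds ?_)
        rw [real_inner_self_eq_norm_sq, hf.normal_unit]; norm_num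
      have h2 : ∀ᶠ z : ℝ × M in 𝓝 (t, p), z.2 ∈ U p ∩ V p :=
        (continuous_snd.tendsto (t, p)).eventually
          (inter_mem ((hU p).2.mem_nhds (hU p).1) (hV p hp))
      obtain ⟨T, hT, A, hA, hTA⟩ :=
        mem_nhds_prod_iff.1 (((hf.eventually_mem_source t p).and h1).and h2)
      refine ⟨T, hT, interior A, isOpen_interior, fun _ => mem_interior_iff_mem_nhds.2 hA,
        fun q hq => (hTA (mk_mem_prod (mem_of_mem_nhds hT) (interior_subset hq))).2,
        fun s hs q hq => (hTA (mk_mem_prod hs (interior_subset hq))).1⟩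
    · exact ⟨univ, univ_mem, ∅, isOpen_empty, fun h => absurd h hp, empty_subset _,
        fun _ _ _ h => absurd h (notMem_empty _)⟩
  choose T hT A hAo hpA hAUV hTA using hgood
  have hcov : ∀ᶠ z in 𝓝 (t, x), ∀ q ∈ (⋃ p ∈ f t ⁻¹' {x}, A p)ᶜ, f z.1 q ≠ z.2 := by
    have hK : IsCompact (⋃ p ∈ f t ⁻¹' {x}, A p)ᶜ :=
      (isOpen_biUnion fun p _ => hAo p).isClosed_compl.isCompact
    refine hK.eventually_forall_of_forall_eventually fun q hq => ?_
    have hne : f t q ≠ x := fun h => hq (mem_biUnion (show q ∈ f t ⁻¹' {x} from h) (hpA q h))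
    have hc1 : Continuous fun z : (ℝ × Space) × M => f z.1.1 z.2 :=
      hf.continuous.comp (by fun_prop : Continuous fun z : (ℝ × Space) × M => (z.1.1, z.2))
    have hc2 : Continuous fun z : (ℝ × Space) × M => z.1.2 := by fun_prop
    exact (isOpen_ne_fun hc1 hc2).mem_nhds hne
  have htime : ∀ᶠ z : ℝ × Space in 𝓝 (t, x), ∀ p ∈ f t ⁻¹' {x}, z.1 ∈ T p := by
    rw [hfin.eventually_all]
    exact fun p _ => (continuous_fst.tendsto (t, x)).eventually (hT p)
  have hback : ∀ᶠ z : ℝ × Space in 𝓝 (t, x), ∀ p ∈ f t ⁻¹' {x},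
      z ∈ (hf.normalCoordinates t p).target ∧ ((hf.normalCoordinates t p).symm z).2.1 ∈ A p := by
    rw [hfin.eventually_all]
    intro p hp
    have hp : f t p = x := hp
    have h1 := hf.tendsto_normalCoordinates_symm t p
    have h2 := (hf.normalCoordinates t p).open_target.mem_nhds (hf.mem_normalCoordinates_target t p)
    rw [hp] at h1 h2
    have h3 : {z : ℝ × M × ℝ | z.2.1 ∈ A p} ∈ 𝓝 (t, p, (0 : ℝ)) :=
      ((hAo p).preimage (by fun_prop : Continuous fun z : ℝ × M × ℝ => z.2.1)).mem_nhds (hpA p hp)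
    exact Filter.Eventually.and h2 (h1.eventually h3)
  filter_upwards [hcov, htime, hback] with z hcov htime hback
  have hβ : ∀ q : f z.1 ⁻¹' {z.2}, ∃ p : f t ⁻¹' {x}, (q : M) ∈ A p := by
    intro q
    have h1 : (q : M) ∈ ⋃ p ∈ f t ⁻¹' {x}, A p := by
      by_contra h
      exact hcov q h q.2
    obtain ⟨p, hp, hpq⟩ := mem_iUnion₂.1 h1
    exact ⟨⟨p, hp⟩, hpq⟩
  choose β hβA using hβ
  have huniq : ∀ p p' : f t ⁻¹' {x}, ∀ q : M, q ∈ A p → q ∈ A p' → p = p' := by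
    intro p p' q h h'
    by_contra hne
    exact Set.disjoint_left.1 (hUd p.2 p'.2 fun h => hne (Subtype.ext h)) (hAUV p h).1
      (hAUV p' h').1
  have hval : ∀ (p : f t ⁻¹' {x}) (q : f z.1 ⁻¹' {z.2}), (q : M) ∈ A p →
      hf.normalCoordinates t p (z.1, q, 0) = z := by
    intro p q hq
    have h2 : f z.1 q = z.2 := q.2
    rw [hf.normalCoordinates_apply t p (hTA p z.1 (htime p p.2) q hq).1]
    simp [h2]
  refine ⟨β, fun q q' h => ?_, fun p => ⟨?_, fun h => ?_⟩, fun q => (hAUV _ (hβA q)).2, fun q => ?_⟩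
  · have h1 := hβA q'
    rw [← h] at h1
    have h3 := (hf.normalCoordinates t (β q)).injOn (hTA _ z.1 (htime _ (β q).2) q (hβA q)).1
      (hTA _ z.1 (htime _ (β q).2) q' h1).1 ((hval _ q (hβA q)).trans (hval _ q' h1).symm)
    exact Subtype.ext (congrArg (fun z : ℝ × M × ℝ => z.2.1) h3)
  · rintro ⟨q, rfl⟩
    have h2 : f z.1 q = z.2 := q.2
    have := hf.sheetFunction_of_mem_source t (β q) (hTA _ z.1 (htime _ (β q).2) q (hβA q)).1
    rwa [h2] at this
  · obtain ⟨h1, h2⟩ := hback p p.2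
    have h3 := hf.eq_normalCoordinates t p h1
    rw [h, zero_smul, add_zero] at h3
    have h4 : z.1 = ((hf.normalCoordinates t p).symm z).1 := congrArg Prod.fst h3
    have h5 : z.2 = f ((hf.normalCoordinates t p).symm z).1
      ((hf.normalCoordinates t p).symm z).2.1 := congrArg Prod.snd h3
    rw [← h4] at h5
    exact ⟨⟨_, h5.symm⟩, huniq _ _ _ (hβA _) h2⟩
  · have h2 : f z.1 q = z.2 := q.2
    obtain ⟨h3, h4⟩ := hTA _ z.1 (htime _ (β q).2) q (hβA q)
    have := hf.eventually_sheetFunction_pos_iff h3 h4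
    rwa [h2] at this

theorem isSheetFamily [CompactSpace M] [T2Space M] (hf : IsRegularHomotopy f ν) (t₀ δ : ℝ) :
    IsSheetFamily (X := fun _ => M) (Metric.ball t₀ δ) f ν hf.sheetFunction where
  isOpen := Metric.isOpen_ball
  finite t _ x := hf.finite_fiber t x
  deriv t _ p := hf.sheetFunction_deriv t p
  zero t _ p := hf.sheetFunction_self t p
  near t _ x := by
    filter_upwards [hf.near_fiber t x (V := fun _ => univ) fun _ _ => univ_mem]
      with z ⟨β, h1, h2, _, h3⟩
    exact ⟨β, h1, h2, h3⟩
  bounded := by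
    obtain ⟨R, hR⟩ := (((isCompact_closedBall t₀ δ).prod (isCompact_univ (X := M))).image
      hf.continuous).isBounded.exists_norm_le
    exact ⟨R, fun t ht p => hR _ ⟨(t, p), ⟨Metric.ball_subset_closedBall ht, mem_univ p⟩, rfl⟩⟩

end IsRegularHomotopy

end SurfaceFamily

/-! ### The slice curve -/

/-- The point of the horizontal plane at height `c` with the horizontal coordinates `y`. -/
def atHeight (y : Plane) (c : ℝ) : Space := !₂[y 0, y 1, c]

theorem horizontal_atHeight (y : Plane) (c : ℝ) : horizontal (atHeight y c) = y := by
  ext i; fin_cases i <;> simp [horizontal, atHeight]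

theorem atHeight_horizontal (x : Space) : atHeight (horizontal x) (x 2) = x := by
  ext i; fin_cases i <;> simp [horizontal, atHeight]

theorem inner_atHeight_zero (n : Space) (v : Plane) :
    inner ℝ n (atHeight v 0) = (inner ℝ (horizontal n) v : ℝ) := by
  simp [PiLp.inner_apply, Fin.sum_univ_three, Fin.sum_univ_two, horizontal, atHeight]

/-- The linear map `horizontal`. -/
def horizontalₗ : Space →ₗ[ℝ] Plane where
  toFun := horizontal
  map_add' x y := by ext i; fin_cases i <;> simp [horizontal]
  map_smul' c x := by ext i; fin_cases i <;> simp [horizontal]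

theorem continuous_horizontal : Continuous horizontal :=
  horizontalₗ.continuous_of_finiteDimensional

/-- The linear map `(y, c) ↦ atHeight y c`. -/
def atHeightL : Plane × ℝ →L[ℝ] Space :=
  LinearMap.toContinuousLinearMap
    { toFun := fun z => atHeight z.1 z.2
      map_add' := fun x y => by ext i; fin_cases i <;> simp [atHeight]
      map_smul' := fun c x => by ext i; fin_cases i <;> simp [atHeight] }

section Slice

variable {M : Type*}

theorem SliceDomain.ext {f : M → Space} {D : Set M} {h : ℝ} {p q : SliceDomain f D h}
    (hpq : p.1 = q.1) : p = q := Subtype.ext hpq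

theorem mem_sliceCurve_fiber {f : M → Space} {D : Set M} {h : ℝ} (p : SliceDomain f D h)
    {y : Plane} : sliceCurve f D h p = y ↔ f p.1 = atHeight y h := by
  constructor
  · rintro rfl
    have h1 : f p.1 2 = h := p.2.2
    exact (atHeight_horizontal _).symm.trans (congrArg (atHeight _) h1)
  · intro hp
    rw [sliceCurve, hp, horizontal_atHeight]

variable [TopologicalSpace M] [ChartedSpace (EuclideanSpace ℝ (Fin 2)) M]
  [IsManifold (𝓡 2) ∞ M] {f ν : ℝ → M → Space}

/-- The slice curve is a sheet family: its sheets are cut out of the sheets of the surface, and it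
has no boundary as the surface meets the slice plane near `D` only in `D`. -/
theorem IsRegularHomotopy.isSheetFamily_slice [CompactSpace M] [T2Space M]
    (hf : IsRegularHomotopy f ν) {D U : Set M} {h : ℝ → ℝ} {t₀ δ : ℝ} (hD : IsClosed D)
    (hU : IsOpen U) (hDU : D ⊆ U)
    (hiso : ∀ t ∈ Metric.ball t₀ δ, ∀ p ∈ U, f t p 2 = h t → p ∈ D)
    (hh : ∀ t ∈ Metric.ball t₀ δ, ∃ h' : ℝ →L[ℝ] ℝ, HasStrictFDerivAt h h' t) :
    IsSheetFamily (X := fun t => SliceDomain (f t) D (h t)) (Metric.ball t₀ δ)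
      (fun t => sliceCurve (f t) D (h t)) (fun t => sliceNormal (f t) (ν t) D (h t))
      (fun t p z => hf.sheetFunction t p.1 (z.1, atHeight z.2 (h z.1))) := by
  have hlift : ∀ t ∈ Metric.ball t₀ δ, ∀ y : Plane, ∃ Λ : ℝ × Plane →L[ℝ] ℝ × Space,
      HasStrictFDerivAt (fun z : ℝ × Plane => (z.1, atHeight z.2 (h z.1))) Λ (t, y) ∧
      ∀ v, Λ (0, v) = (0, atHeight v 0) := by
    intro t ht y
    obtain ⟨h', hh'⟩ := hh t ht
    have h1 : HasStrictFDerivAt (fun z : ℝ × Plane => h z.1)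
        (h'.comp (ContinuousLinearMap.fst ℝ ℝ Plane)) (t, y) :=
      HasStrictFDerivAt.comp (g := h) (t, y) hh' hasStrictFDerivAt_fst
    refine ⟨_, hasStrictFDerivAt_fst.prodMk
      (atHeightL.hasStrictFDerivAt.comp (t, y) (hasStrictFDerivAt_snd.prodMk h1)), fun v => ?_⟩
    change ((0 : ℝ), atHeight v (h' 0)) = _
    rw [map_zero]
  have hlift' : ∀ t ∈ Metric.ball t₀ δ, ∀ y : Plane,
      Tendsto (fun z : ℝ × Plane => (z.1, atHeight z.2 (h z.1))) (𝓝 (t, y))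
        (𝓝 (t, atHeight y (h t))) := by
    intro t ht y
    obtain ⟨Λ, hΛ, _⟩ := hlift t ht y
    exact hΛ.continuousAt
  refine ⟨Metric.isOpen_ball, fun t _ x => ?_, fun t ht p => ?_, fun t _ p => ?_, fun t ht x => ?_,
    ?_⟩
  · refine Set.Finite.of_finite_image (f := Subtype.val) ?_ Subtype.val_injective.injOn
    refine (hf.finite_fiber t (atHeight x (h t))).subset ?_
    rintro _ ⟨p, hp, rfl⟩
    exact (mem_sliceCurve_fiber p).1 hp
  · have hp := (mem_sliceCurve_fiber p).1 rfl
    obtain ⟨L, hL, hLν⟩ := hf.sheetFunction_deriv t p.1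
    obtain ⟨Λ, hΛ, hΛ0⟩ := hlift t ht (sliceCurve (f t) D (h t) p)
    rw [hp] at hL
    refine ⟨L.comp Λ, hL.comp (t, sliceCurve (f t) D (h t) p) hΛ, fun v => ?_⟩
    rw [ContinuousLinearMap.comp_apply, hΛ0, hLν, inner_atHeight_zero]
    rfl
  · have hp := (mem_sliceCurve_fiber p).1 rfl
    change hf.sheetFunction t p.1 (t, atHeight _ (h t)) = 0
    rw [← hp, hf.sheetFunction_self]
  · classical
    -- the sheets through `D` stay in `D`, the others stay outside
    have hV : ∀ p, f t p = atHeight x (h t) → (if p ∈ D then U else Dᶜ) ∈ 𝓝 p := by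
      intro p _
      split_ifs with hp
      · exact hU.mem_nhds (hDU hp)
      · exact hD.isOpen_compl.mem_nhds hp
    filter_upwards [(hlift' t ht x).eventually (hf.near_fiber t _ hV),
      (continuous_fst.tendsto (t, x)).eventually (Metric.isOpen_ball.mem_nhds ht)]
      with z ⟨β, hβi, hβr, hβV, hβs⟩ hz
    have hmem : ∀ q : (sliceCurve (f z.1) D (h z.1)) ⁻¹' {z.2},
        f z.1 q.1.1 = atHeight z.2 (h z.1) := fun q => (mem_sliceCurve_fiber q.1).1 q.2
    have hβD : ∀ q : f z.1 ⁻¹' {atHeight z.2 (h z.1)}, (β q : M) ∈ D ↔ (q : M) ∈ D := by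
      intro q
      have h1 := hβV q
      by_cases h2 : (β q : M) ∈ D
      · rw [if_pos h2] at h1
        refine iff_of_true h2 (hiso z.1 hz q h1 ?_)
        have h3 : f z.1 q = atHeight z.2 (h z.1) := q.2
        rw [h3]; simp [atHeight]
      · rw [if_neg h2] at h1
        exact iff_of_false h2 h1
    have hheight : ∀ p : f t ⁻¹' {atHeight x (h t)}, f t p 2 = h t := by
      intro p
      have h3 : f t p = atHeight x (h t) := p.2
      rw [h3]; simp [atHeight]
    let β' : (sliceCurve (f z.1) D (h z.1)) ⁻¹' {z.2} → (sliceCurve (f t) D (h t)) ⁻¹' {x} :=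
      fun q => ⟨⟨β ⟨q.1.1, hmem q⟩, fun hD => q.1.2.1 ((hβD _).1 hD), hheight _⟩,
        (mem_sliceCurve_fiber _).2 (β ⟨q.1.1, hmem q⟩).2⟩
    refine ⟨β', fun q q' hqq => ?_, fun p => ⟨?_, fun h0 => ?_⟩, fun q => ?_⟩
    · have h1 : ((β ⟨q.1.1, hmem q⟩ : M)) = β ⟨q'.1.1, hmem q'⟩ :=
        congrArg (fun r : (sliceCurve (f t) D (h t)) ⁻¹' {x} => r.1.1) hqq
      have h2 := hβi (Subtype.ext h1)
      exact Subtype.ext (SliceDomain.ext (congrArg Subtype.val h2 :))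
    · rintro ⟨q, rfl⟩
      exact (hβr _).1 (mem_range_self (⟨q.1.1, hmem q⟩ : f z.1 ⁻¹' {atHeight z.2 (h z.1)}))
    · have hp : f t p.1.1 = atHeight x (h t) := (mem_sliceCurve_fiber p.1).1 p.2
      obtain ⟨q, hq⟩ := (hβr ⟨p.1.1, hp⟩).2 h0
      have hq1 : f z.1 q = atHeight z.2 (h z.1) := q.2
      have hqD : (q : M) ∉ D := fun h => p.1.2.1 (by
        have := (hβD q).2 h
        rwa [hq] at this)
      have hqh : f z.1 q 2 = h z.1 := by rw [hq1]; simp [atHeight]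
      refine ⟨⟨⟨q, hqD, hqh⟩, (mem_sliceCurve_fiber _).2 hq1⟩, ?_⟩
      exact Subtype.ext (SliceDomain.ext (congrArg Subtype.val hq :))
    · exact (hlift' z.1 hz z.2).eventually (hβs ⟨q.1.1, hmem q⟩)
  · obtain ⟨R, hR⟩ := ((((isCompact_closedBall t₀ δ).prod (isCompact_univ (X := M))).image
      hf.continuous).image continuous_horizontal).isBounded.exists_norm_le
    exact ⟨R, fun t ht p => hR _
      ⟨_, ⟨(t, p.1), ⟨Metric.ball_subset_closedBall ht, mem_univ p.1⟩, rfl⟩, rfl⟩⟩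

end Slice

/-! ### The quadruple point -/

section Event

variable {M : Type*} {f ν : ℝ → M → Space} {t₀ : ℝ} {x₀ : Space} {q : Fin 4 → M}

theorem IsQuadruplePointEvent.apply (hQ : IsQuadruplePointEvent f ν t₀ x₀ q) (i : Fin 4) :
    f t₀ (q i) = x₀ := by
  have : q i ∈ f t₀ ⁻¹' {x₀} := hQ.fiber ▸ mem_range_self i
  exact this

theorem IsQuadruplePointEvent.exists_eq (hQ : IsQuadruplePointEvent f ν t₀ x₀ q) {p : M}
    (hp : f t₀ p = x₀) : ∃ i, q i = p := by
  have : p ∈ f t₀ ⁻¹' {x₀} := hp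
  rwa [hQ.fiber] at this

/-- General position, for sets of sheets instead of indices. -/
theorem IsQuadruplePointEvent.linearIndependent (hQ : IsQuadruplePointEvent f ν t₀ x₀ q)
    (S : Finset M) (hS : ∀ p ∈ S, f t₀ p = x₀) (hcard : S.card = 3) :
    LinearIndependent ℝ (fun p : S => ν t₀ p) := by
  classical
  choose i hi using fun p : S => hQ.exists_eq (hS p p.2)
  obtain ⟨j, hj⟩ : ∃ j, q j ∉ S := by
    by_contra! h
    have h1 : Finset.univ.image q ⊆ S := fun p hp => by
      obtain ⟨j, _, rfl⟩ := Finset.mem_image.1 hp; exact h j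
    have h2 := Finset.card_le_card h1
    rw [Finset.card_image_of_injective _ hQ.injective, hcard] at h2
    simp at h2
  have hij : ∀ p, i p ≠ j := fun p h => hj (by rw [← h, hi]; exact p.2)
  have h := (hQ.general_position j).comp (fun p : S => ⟨i p, hij p⟩) (fun p p' h => by
    have h' : i p = i p' := congrArg Subtype.val h
    exact Subtype.ext (by rw [← hi p, ← hi p', h']))
  have he : ((fun k : {k : Fin 4 // k ≠ j} => ν t₀ (q k)) ∘ fun p : S => ⟨i p, hij p⟩) =
      fun p : S => ν t₀ p := funext fun p => by simp [hi]
  rwa [he] at h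

theorem mem_span_of_horizontal_eq_zero {v : Space} (hv : horizontal v = 0) :
    v ∈ Submodule.span ℝ {(EuclideanSpace.single 2 1 : Space)} := by
  rw [Submodule.mem_span_singleton]
  refine ⟨v 2, ?_⟩
  have h0 := congrArg (fun w : Plane => w 0) hv
  have h1 := congrArg (fun w : Plane => w 1) hv
  ext i; fin_cases i <;> simp_all [horizontal]

variable [TopologicalSpace M]

/-- Two sheets in `D` would have the same normal, contrary to general position. -/
theorem IsSlicePlane.notMem (hQ : IsQuadruplePointEvent f ν t₀ x₀ q) {D : Set M} {h : ℝ → ℝ}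
    (hD : IsSlicePlane f ν t₀ x₀ q D h) {i : Fin 4} (hi : i ≠ 0) : q i ∉ D := by
  intro hiD
  obtain ⟨j, hj0, hji⟩ := (by decide : ∀ i : Fin 4, i ≠ 0 → ∃ j, 0 ≠ j ∧ i ≠ j) i hi
  have hν := hD.coorientation.self_of_nhds
  have h1 := (hQ.general_position j).injective (a₁ := ⟨i, hji⟩) (a₂ := ⟨0, hj0⟩)
    ((hν _ hiD).trans (hν _ (interior_subset hD.mem_interior)).symm)
  exact hi (congrArg Subtype.val h1)

/-- Any two of the slice curves through the projection of the quadruple point are transverse, as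
the corresponding two sheets and the horizontal moving sheet are. -/
theorem IsSlicePlane.linearIndependent (hQ : IsQuadruplePointEvent f ν t₀ x₀ q) {D : Set M}
    {h : ℝ → ℝ} (hD : IsSlicePlane f ν t₀ x₀ q D h) (S : Finset (SliceDomain (f t₀) D (h t₀)))
    (hS : ∀ p ∈ S, f t₀ p.1 = x₀) (hcard : S.card = 2) :
    LinearIndependent ℝ (fun p : S => sliceNormal (f t₀) (ν t₀) D (h t₀) p) := by
  classical
  have hq0 : q 0 ∈ D := interior_subset hD.mem_interior
  have hinj : Function.Injective (fun p : SliceDomain (f t₀) D (h t₀) => p.1) :=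
    fun p p' h => SliceDomain.ext h
  let S' : Finset M := insert (q 0) (S.image fun p => p.1)
  have h0 : q 0 ∉ S.image fun p => p.1 := fun h0 => by
    obtain ⟨p, _, hp⟩ := Finset.mem_image.1 h0
    exact p.2.1 (hp ▸ hq0)
  have hS' : S'.card = 3 := by
    rw [Finset.card_insert_of_notMem h0, Finset.card_image_of_injective _ hinj, hcard]
  have hli := hQ.linearIndependent S' (fun p hp => by
    rcases Finset.mem_insert.1 hp with rfl | hp
    · exact hQ.apply 0
    · obtain ⟨p', hp', rfl⟩ := Finset.mem_image.1 hp
      exact hS p' hp') hS'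
  let j : S → S' := fun p => ⟨p.1.1, Finset.mem_insert_of_mem (Finset.mem_image_of_mem _ p.2)⟩
  let j₀ : S' := ⟨q 0, Finset.mem_insert_self _ _⟩
  have hj : Function.Injective j := fun p p' h =>
    Subtype.ext (hinj (congrArg (fun r : S' => (r : M)) h))
  have hdisj := hli.disjoint_span_image (s := range j) (t := {j₀}) (by
    rw [Set.disjoint_singleton_right]
    rintro ⟨p, hp⟩
    exact p.1.2.1 (by
      have : p.1.1 = q 0 := congrArg (fun r : S' => (r : M)) hp
      rw [this]; exact hq0))
  refine (hli.comp j hj).map (f := horizontalₗ) (hdisj.mono ?_ ?_)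
  · rw [range_comp]
  · intro v hv
    rw [image_singleton, hD.coorientation.self_of_nhds _ hq0]
    exact mem_span_of_horizontal_eq_zero hv

variable [ChartedSpace (EuclideanSpace ℝ (Fin 2)) M]

/-- The height of the slice plane is smooth in time, being the height of a point of the surface. -/
theorem IsRegularHomotopy.hasStrictFDerivAt_apply (hf : IsRegularHomotopy f ν) (p : M) (t : ℝ)
    {h : ℝ → ℝ} (hh : ∀ᶠ s in 𝓝 t, f s p 2 = h s) :
    ∃ h' : ℝ →L[ℝ] ℝ, HasStrictFDerivAt h h' t := by
  have h1 : ContMDiff 𝓘(ℝ, ℝ) 𝓘(ℝ, Space) ∞ (fun s => f s p) :=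
    hf.smooth.comp (contMDiff_id.prodMk contMDiff_const : ContMDiff 𝓘(ℝ, ℝ) (𝓘(ℝ, ℝ).prod (𝓡 2)) ∞
      (fun s : ℝ => (s, p)))
  have h2 := h1.contDiff.contDiffAt.hasStrictFDerivAt (x := t) (by simp)
  have h3 := (EuclideanSpace.proj (𝕜 := ℝ) (2 : Fin 3)).hasStrictFDerivAt.comp t h2
  exact ⟨_, h3.congr_of_eventuallyEq hh⟩

variable [IsManifold (𝓡 2) ∞ M]

/-- Near an interior point of the moving sheet, its defining function is the height above the slice
plane. -/
theorem IsSlicePlane.eventually_sheetFunction (hf : IsRegularHomotopy f ν) {D : Set M} {h : ℝ → ℝ}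
    (hD : IsSlicePlane f ν t₀ x₀ q D h) :
    ∀ᶠ z in 𝓝 (t₀, f t₀ (q 0)), hf.sheetFunction t₀ (q 0) z = z.2 2 - h z.1 := by
  have hsymm := hf.tendsto_normalCoordinates_symm t₀ (q 0)
  have hD1 : ∀ᶠ z : ℝ × M × ℝ in 𝓝 (t₀, q 0, (0 : ℝ)), z.2.1 ∈ D := by
    have h1 : Tendsto (fun z : ℝ × M × ℝ => z.2.1) (𝓝 (t₀, q 0, (0 : ℝ))) (𝓝 (q 0)) :=
      Continuous.tendsto (by fun_prop) (t₀, q 0, (0 : ℝ))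
    exact h1.eventually (mem_interior_iff_mem_nhds.1 hD.mem_interior)
  have hD2 : ∀ᶠ z : ℝ × M × ℝ in 𝓝 (t₀, q 0, (0 : ℝ)), ∀ p ∈ D, f z.1 p 2 = h z.1 :=
    (continuous_fst.tendsto (t₀, q 0, (0 : ℝ))).eventually hD.height
  filter_upwards [hsymm.eventually hD1, hsymm.eventually hD2,
    (hf.normalCoordinates t₀ (q 0)).open_target.mem_nhds
      (hf.mem_normalCoordinates_target t₀ (q 0))] with z h1 h2 h3
  have h4 := hf.eq_normalCoordinates t₀ (q 0) h3
  rw [hD.coorientation.self_of_nhds _ (interior_subset hD.mem_interior)] at h4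
  have h5 : z.1 = _ := congrArg Prod.fst h4
  have h6 : z.2 = _ := congrArg Prod.snd h4
  have h7 := congrArg (fun w : Space => w 2) h6
  simp only [PiLp.add_apply, PiLp.smul_apply] at h7
  rw [h2 _ h1, ← h5] at h7
  simp at h7
  linarith

end Event

/-- Apart from a constant, `StTwo` of the surface exceeds `sliceStOne` by one as long as the triple
point `T t` lies on the positive side of the slice plane. Each of the two invariants counts sheets
with the intersection point of the remaining sheets on the positive side, and for the three sheets
other than the moving one the two counts coincide. -/
theorem IsSlicePlane.eventually_StTwo_eq {M : Type*} [TopologicalSpace M] [T2Space M]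
    [CompactSpace M] [ChartedSpace (EuclideanSpace ℝ (Fin 2)) M] [IsManifold (𝓡 2) ∞ M]
    {f ν : ℝ → M → Space} (hf : IsRegularHomotopy f ν)
    {t₀ : ℝ} {x₀ : Space} {q : Fin 4 → M} (hQ : IsQuadruplePointEvent f ν t₀ x₀ q)
    {D : Set M} {h : ℝ → ℝ} (hD : IsSlicePlane f ν t₀ x₀ q D h)
    {T : ℝ → Space} {p : Fin 4 → ℝ → M} (hT : Tendsto T (𝓝 t₀) (𝓝 x₀))
    (hp : ∀ i, i ≠ 0 → Tendsto (p i) (𝓝 t₀) (𝓝 (q i)) ∧ ∀ᶠ t in 𝓝 t₀, f t (p i t) = T t) :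
    ∃ C : ℝ → ℝ, ∀ᶠ t in 𝓝[≠] t₀, ∀ c, StTwo (f t) (ν t) =
      sliceStOne c (f t) (ν t) D (h t) + C c + if h t < T t 2 then 1 else 0 := by
  classical
  have hq0 : q 0 ∈ D := interior_subset hD.mem_interior
  obtain ⟨U, hU, hDU, hUiso⟩ := hD.isolated
  obtain ⟨δ, hδ, hδb⟩ := Metric.eventually_nhds_iff_ball.1 (hD.height.and hUiso)
  have ht₀ : t₀ ∈ Metric.ball t₀ δ := Metric.mem_ball_self hδ
  have hx₀h : x₀ 2 = h t₀ := by rw [← hQ.apply 0]; exact hD.height.self_of_nhds _ hq0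
  have hat : atHeight (horizontal x₀) (h t₀) = x₀ := by rw [← hx₀h, atHeight_horizontal]
  have H₂ := hf.isSheetFamily t₀ δ
  have H₁ := hf.isSheetFamily_slice (h := h) hD.closed hU hDU (fun t ht => (hδb t ht).2)
    fun t ht => hf.hasStrictFDerivAt_apply (q 0) t (by
      filter_upwards [Metric.isOpen_ball.mem_nhds ht] with s hs using (hδb s hs).1 _ hq0)
  set g := hf.sheetFunction
  -- for each sheet through `x₀`, the intersection point of the other three sheets
  have hY : ∀ i : Fin 4, ∃ Y : ℝ → Space, (i = 0 → Y = T) ∧ Tendsto Y (𝓝 t₀) (𝓝 x₀) ∧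
      ∀ j, j ≠ i → ∀ᶠ t in 𝓝 t₀, g t₀ (q j) (t, Y t) = 0 := by
    intro i
    by_cases hi : i = 0
    · subst hi
      refine ⟨T, fun _ => rfl, hT, fun j hj => ?_⟩
      have h1 : Tendsto (fun t => (t, p j t)) (𝓝 t₀) (𝓝 (t₀, q j)) :=
        tendsto_id.prodMk_nhds (hp j hj).1
      filter_upwards [h1.eventually (hf.eventually_sheetFunction_eq_zero t₀ (q j)), (hp j hj).2]
        with t h1 h2
      rwa [h2] at h1
    · let S : Finset M := (Finset.univ.erase i).image q
      have hS : ∀ p ∈ S, f t₀ p = x₀ := fun p hp => by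
        obtain ⟨j, _, rfl⟩ := Finset.mem_image.1 hp; exact hQ.apply j
      have hScard : S.card = 3 := by
        rw [Finset.card_image_of_injective _ hQ.injective, Finset.card_erase_of_mem
          (Finset.mem_univ i)]; rfl
      obtain ⟨Y, hY1, hY2, _⟩ := H₂.exists_intersection ht₀ hS (by simpa using hScard)
        (hQ.linearIndependent S hS hScard)
      refine ⟨Y, fun h => absurd h hi, hY1, fun j hj => ?_⟩
      filter_upwards [hY2] with t ht
      exact ht _ (Finset.mem_image_of_mem _ (Finset.mem_erase.2 ⟨hj, Finset.mem_univ j⟩))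
  choose Y hYT hYx hYg using hY
  let ι : M → Fin 4 := Function.invFun q
  have hι : ∀ i, ι (q i) = i := Function.leftInverse_invFun hQ.injective
  have hprop : ∀ i, i ≠ 0 → ∀ᶠ t in 𝓝 t₀, atHeight (horizontal (Y i t)) (h t) = Y i t := by
    intro i hi
    have h1 : Tendsto (fun t => (t, Y i t)) (𝓝 t₀) (𝓝 (t₀, f t₀ (q 0))) := by
      rw [hQ.apply 0]; exact tendsto_id.prodMk_nhds (hYx i)
    filter_upwards [h1.eventually (hD.eventually_sheetFunction hf), hYg i 0 hi.symm] with t h1 h2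
    have h3 : h t = Y i t 2 := by
      have h4 := h1.symm.trans h2
      linarith
    rw [h3, atHeight_horizontal]
  obtain ⟨C₂, hC₂⟩ := H₂.exists_sum_pointIndex_eq ht₀ (by simp) hQ.generic_near
    hQ.generic_elsewhere (by
      rw [hQ.fiber, ← image_univ, ncard_image_of_injective _ hQ.injective, ncard_univ]
      simp) (fun S hS hc => hQ.linearIndependent S hS (by simpa using hc))
    (Y := fun p => Y (ι p)) (fun p _ => hYx _) (by
      intro p hp p' hp' hne
      obtain ⟨i, rfl⟩ := hQ.exists_eq hp
      obtain ⟨j, rfl⟩ := hQ.exists_eq hp'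
      simp only [hι]
      exact hYg i j fun h => hne (by rw [h]))
  -- the sheets of the slice curve through the projection of `x₀`
  have hslice : ∀ p : SliceDomain (f t₀) D (h t₀),
      sliceCurve (f t₀) D (h t₀) p = horizontal x₀ ↔ f t₀ p.1 = x₀ := fun p => by
    rw [mem_sliceCurve_fiber, hat]
  have hexists : ∀ p : SliceDomain (f t₀) D (h t₀), f t₀ p.1 = x₀ → ∃ i, i ≠ 0 ∧ q i = p.1 := by
    intro p hp
    obtain ⟨i, hi⟩ := hQ.exists_eq hp
    exact ⟨i, fun h0 => p.2.1 (by rw [← hi, h0]; exact hq0), hi⟩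
  have hmk : ∀ i, i ≠ 0 → ∃ p : SliceDomain (f t₀) D (h t₀), p.1 = q i ∧ f t₀ p.1 = x₀ :=
    fun i hi => ⟨⟨q i, hD.notMem hQ hi, by rw [hQ.apply]; exact hx₀h⟩, rfl, hQ.apply i⟩
  have hvalinj : Function.Injective (fun p : SliceDomain (f t₀) D (h t₀) => p.1) :=
    fun p p' h => SliceDomain.ext h
  obtain ⟨C₁, hC₁⟩ := H₁.exists_sum_pointIndex_eq ht₀ (x₀ := horizontal x₀) (by simp)
    hD.generic_near hD.generic_elsewhere (by
      have h1 : (fun p : SliceDomain (f t₀) D (h t₀) => p.1) ''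
          (sliceCurve (f t₀) D (h t₀) ⁻¹' {horizontal x₀}) = q '' {i | i ≠ 0} := by
        ext p
        constructor
        · rintro ⟨p, hp, rfl⟩
          exact hexists p ((hslice p).1 hp)
        · rintro ⟨i, hi, rfl⟩
          obtain ⟨p, hp1, hp2⟩ := hmk i hi
          exact ⟨p, (hslice p).2 hp2, hp1⟩
      rw [← ncard_image_of_injective _ hvalinj, h1, ncard_image_of_injective _ hQ.injective]
      have : {i : Fin 4 | i ≠ 0} = ((Finset.univ.erase 0 : Finset (Fin 4)) : Set (Fin 4)) := by
        ext i; simp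
      rw [this, ncard_coe_finset]
      simp) (fun S hS hc => hD.linearIndependent hQ S (fun p hp => (hslice p).1 (hS p hp))
      (by simpa using hc))
    (Y := fun p t => horizontal (Y (ι p.1) t))
    (fun p _ => (continuous_horizontal.tendsto _).comp (hYx _)) (by
      intro p hp p' hp' hne
      obtain ⟨i, hi, hip⟩ := hexists p ((hslice p).1 hp)
      obtain ⟨j, hj, hjp⟩ := hexists p' ((hslice p').1 hp')
      have hij : j ≠ i := fun h => hne (SliceDomain.ext (by rw [← hip, ← hjp, h]))
      simp only [← hip, ← hjp, hι]
      filter_upwards [hYg i j hij, hprop i hi] with t h1 h2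
      rwa [h2])
  have hT0 : ∀ᶠ t in 𝓝 t₀, g t₀ (q 0) (t, T t) = T t 2 - h t := by
    have h1 : Tendsto (fun t => (t, T t)) (𝓝 t₀) (𝓝 (t₀, f t₀ (q 0))) := by
      rw [hQ.apply 0]; exact tendsto_id.prodMk_nhds hT
    exact h1.eventually (hD.eventually_sheetFunction hf)
  have hprop' : ∀ᶠ t in 𝓝 t₀, ∀ i, i ≠ 0 → atHeight (horizontal (Y i t)) (h t) = Y i t := by
    rw [eventually_all]
    intro i
    by_cases hi : i = 0
    · exact .of_forall fun _ h => absurd hi h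
    · filter_upwards [hprop i hi] with t ht _ using ht
  refine ⟨fun c => C₂ (-3 / 2) - C₁ c, ?_⟩
  filter_upwards [hC₂, hC₁, nhdsWithin_le_nhds hT0, nhdsWithin_le_nhds hprop']
    with t h₂ h₁ hT0 hprop c
  have h₂ := h₂ (-3 / 2)
  have h₁ := h₁ c
  rw [finrank_euclideanSpace_fin] at h₁ h₂
  change StTwo (f t) (ν t) = _ at h₂
  change sliceStOne c (f t) (ν t) D (h t) = _ at h₁
  -- besides the moving sheet, the positive sheets are those of the slice curve
  have hcount : {p : M | f t₀ p = x₀ ∧ 0 < g t₀ p (t, Y (ι p) t)} =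
      (fun p : SliceDomain (f t₀) D (h t₀) => p.1) '' {p : SliceDomain (f t₀) D (h t₀) |
        sliceCurve (f t₀) D (h t₀) p = horizontal x₀ ∧
        0 < g t₀ p.1 (t, atHeight (horizontal (Y (ι p.1) t)) (h t))} ∪
      if h t < T t 2 then {q 0} else ∅ := by
    ext p
    constructor
    · rintro ⟨hp, h0⟩
      obtain ⟨i, rfl⟩ := hQ.exists_eq hp
      rw [hι] at h0
      by_cases hi : i = 0
      · subst hi
        rw [hYT 0 rfl, hT0, sub_pos] at h0
        exact Or.inr (by rw [if_pos h0]; rfl)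
      · obtain ⟨p, hp1, hp2⟩ := hmk i hi
        refine Or.inl ⟨p, ⟨(hslice p).2 hp2, ?_⟩, hp1⟩
        rwa [hp1, hι, hprop i hi]
    · rintro (⟨p, ⟨hp, h0⟩, rfl⟩ | hp)
      · obtain ⟨i, hi, hip⟩ := hexists p ((hslice p).1 hp)
        rw [← hip, hι, hprop i hi] at h0
        refine ⟨(hslice p).1 hp, ?_⟩
        simp only [← hip, hι]
        exact h0
      · split_ifs at hp with hlt
        · rw [mem_singleton_iff.1 hp]
          refine ⟨hQ.apply 0, ?_⟩
          rw [hι, hYT 0 rfl, hT0, sub_pos]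
          exact hlt
        · exact absurd hp (notMem_empty _)
  have hfin : {p : SliceDomain (f t₀) D (h t₀) |
        sliceCurve (f t₀) D (h t₀) p = horizontal x₀ ∧
        0 < g t₀ p.1 (t, atHeight (horizontal (Y (ι p.1) t)) (h t))}.Finite :=
    (H₁.finite t₀ ht₀ (horizontal x₀)).subset fun p hp => hp.1
  have hdisj : Disjoint ((fun p : SliceDomain (f t₀) D (h t₀) => p.1) ''
      {p : SliceDomain (f t₀) D (h t₀) | sliceCurve (f t₀) D (h t₀) p = horizontal x₀ ∧
        0 < g t₀ p.1 (t, atHeight (horizontal (Y (ι p.1) t)) (h t))})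
      (if h t < T t 2 then {q 0} else ∅) := by
    rw [Set.disjoint_left]
    rintro _ ⟨p, _, rfl⟩ hp
    split_ifs at hp
    · have h0 : p.1 = q 0 := mem_singleton_iff.1 hp
      exact p.2.1 (by rw [h0]; exact hq0)
    · exact hp
  rw [hcount, ncard_union_eq hdisj (hfin.image _) (by split_ifs <;> simp),
    ncard_image_of_injective _ hvalinj] at h₂
  rw [h₂, h₁]
  split_ifs <;> simp <;> ring

end

theorem mainTheorem2 {M : Type*} [TopologicalSpace M] [T2Space M] [CompactSpace M]
    [ChartedSpace (EuclideanSpace ℝ (Fin 2)) M] [IsManifold (𝓡 2) ∞ M]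
    (f ν : ℝ → M → Space) (hf : IsRegularHomotopy f ν)
    (t₀ : ℝ) (x₀ : Space) (q : Fin 4 → M) (hQ : IsQuadruplePointEvent f ν t₀ x₀ q)
    (D : Set M) (h : ℝ → ℝ) (hD : IsSlicePlane f ν t₀ x₀ q D h)
    (d : Transition) (hd : IsLocalTransition f t₀ x₀ q h d) :
    ∃ ε > 0, ∀ t₁ ∈ Ioo (t₀ - ε) t₀, ∀ t₂ ∈ Ioo t₀ (t₀ + ε), ∀ c : ℝ,
      StTwo (f t₂) (ν t₂) - StTwo (f t₁) (ν t₁) =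
        (sliceStOne c (f t₂) (ν t₂) D (h t₂) - sliceStOne c (f t₁) (ν t₁) D (h t₁)) + d.sgn := by
  obtain ⟨T, p, hT, hp, hd⟩ := hd
  obtain ⟨C, hC⟩ := hD.eventually_StTwo_eq hf hQ hT hp
  have hleft : ∀ᶠ t in 𝓝[<] t₀, ∀ c, StTwo (f t) (ν t) =
      sliceStOne c (f t) (ν t) D (h t) + C c + if h t < T t 2 then 1 else 0 :=
    hC.filter_mono (nhdsWithin_mono _ fun _ ht => ne_of_lt ht)
  have hright : ∀ᶠ t in 𝓝[>] t₀, ∀ c, StTwo (f t) (ν t) =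
      sliceStOne c (f t) (ν t) D (h t) + C c + if h t < T t 2 then 1 else 0 :=
    hC.filter_mono (nhdsWithin_mono _ fun _ ht => ne_of_gt ht)
  have hε : ∀ {P Q : ℝ → Prop}, (∀ᶠ t in 𝓝[<] t₀, P t) → (∀ᶠ t in 𝓝[>] t₀, Q t) →
      ∃ ε > 0, (∀ t ∈ Ioo (t₀ - ε) t₀, P t) ∧ ∀ t ∈ Ioo t₀ (t₀ + ε), Q t := by
    intro P Q hP hQ
    obtain ⟨ε, hε, hP⟩ := Metric.mem_nhdsWithin_iff.1 hP
    obtain ⟨ε', hε', hQ⟩ := Metric.mem_nhdsWithin_iff.1 hQ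
    refine ⟨min ε ε', lt_min hε hε', fun t ht => hP ⟨?_, ht.2⟩, fun t ht => hQ ⟨?_, ht.1⟩⟩
    · rw [Metric.mem_ball, Real.dist_eq, abs_lt]
      constructor <;> linarith [ht.1, ht.2, min_le_left ε ε']
    · rw [Metric.mem_ball, Real.dist_eq, abs_lt]
      constructor <;> linarith [ht.1, ht.2, min_le_right ε ε']
  cases d with
  | upward =>
    obtain ⟨ε, hε, h₁, h₂⟩ := hε (hleft.and hd.1) (hright.and hd.2)
    refine ⟨ε, hε, fun t₁ ht₁ t₂ ht₂ c => ?_⟩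
    rw [(h₁ t₁ ht₁).1 c, (h₂ t₂ ht₂).1 c, if_pos (h₁ t₁ ht₁).2, if_neg (h₂ t₂ ht₂).2.not_gt,
      Transition.sgn]
    ring
  | downward =>
    obtain ⟨ε, hε, h₁, h₂⟩ := hε (hleft.and hd.1) (hright.and hd.2)
    refine ⟨ε, hε, fun t₁ ht₁ t₂ ht₂ c => ?_⟩
    rw [(h₁ t₁ ht₁).1 c, (h₂ t₂ ht₂).1 c, if_neg (h₁ t₁ ht₁).2.not_gt, if_pos (h₂ t₂ ht₂).2,
      Transition.sgn]
    ring
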